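/- **Setting.** Let $(\mathcal X,\mathcal B)$ be a measurable space and $X_1,\dots,X_n$ an i.i.d. sample from a probability measure $P_0$ on it, with empirical measure $\mathbb P_n$; write $Pf=\int f\,dP$ and $\mathbb G_n=n^{1/2}(\mathbb P_n-P_0)$. Let $T(\eta,P)\in\mathbb R$ be a function of a nuisance value $\eta\in\mathcal H$ and a distribution $P$, let $\eta_0\in\mathcal H$, and let the parameter of interest be $\psi_0=T(\eta_0,P_0)$. Let $\phi_0:\mathcal X\to\mathbb R$ be a function with $P_0\phi_0=0$ and $P_0\phi_0^2<\infty$, and put $\sigma_0^2=P_0\phi_0^2$, $\sigma_0\ge 0$. Let $\eta_n\in\mathcal H$ and $\phi_n:\mathcal X\to\mathbb R$ be arbitrary (possibly non-measurable) functions of $X_1,\dots,X_n$. Let $W_{n1},\dots,W_{nn}$ be i.i.d. with law $Q_n$ on a measurable space, independent of the data, and let $X_i^*=\gamma_n(X_1,\dots,X_n,W_{ni})$ with $\gamma_n$ a fixed measurable function. Let $\hat P_n$ be the conditional law of $X_i^*$ given the data, $\mathbb P_n^*$ the empirical measure of $X_1^*,\dots,X_n^*$ and $\mathbb G_n^*=n^{1/2}(\mathbb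 P_n^*-\hat P_n)$. Let $\eta_n^*\in\mathcal H$ and $\phi_n^*:\mathcal X\to\mathbb R$ be arbitrary functions of the data and of the bootstrap sample. Put $$R_n=T(\eta_n,\mathbb P_n)-T(\eta_0,P_0)-(\mathbb P_n-P_0)\phi_n,\qquad R_n^*=T(\eta_n^*,\mathbb P_n^*)-T(\eta_n,\hat P_n)-(\mathbb P_n^*-\hat P_n)\phi_n^*,$$ $$T_n^*=n^{1/2}\,[T(\eta_n^*,\mathbb P_n^*)-T(\eta_n,\hat P_n)].$$ $E_0^*,P_0^*$ denote outer expectation and outer probability for the law of the data, and $E_W^*,P_W^*$ those for the law of $(W_{n1},\dots,W_{nn})$ with the data held fixed. $Y_n\xrightarrow{P_0^*}c$ means $P_0^*(|Y_n-c|\ge\varepsilon)\to0$ for every $\varepsilon>0$; $Y_n=o_{P_0^*}(r_n)$ means $Y_n/r_n\xrightarrow{P_0^*}0$; $Y_n=o_{P_W^*}(r_n)$ means $P_W^*(|Y_n|/r_n\ge\varepsilon)\xrightarrow{P_0^*}0$ for every $\varepsilon>0$. For a class $\mathcal F$ of functions, $\ell^\infty(\mathcal F)$ is the space of bounded real functions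 on $\mathcal F$ with the supremum norm, and a $P_0$-Brownian bridge $\mathbb G_0$ on $\mathcal F\subset L_2(P_0)$ is a tight, Borel measurable random element of $\ell^\infty(\mathcal F)$ that is a mean-zero Gaussian process with covariance $P_0(fg)-P_0f\,P_0g$. **Conditions.** * (A1) There is a class $\mathcal F$ of measurable functions $\mathcal X\to\mathbb R$ with $\phi_0\in\mathcal F$ and $P_0^*(\phi_n\notin\mathcal F)\to0$ such that $\mathbb G_n\rightsquigarrow\mathbb G_0$ in $\ell^\infty(\mathcal F)$ for a $P_0$-Brownian bridge $\mathbb G_0$, i.e. $E_0^*h(\mathbb G_n)\to E\,h(\mathbb G_0)$ for every bounded continuous $h:\ell^\infty(\mathcal F)\to\mathbb R$. * (A2) $\|\phi_n-\phi_0\|_{L_2(P_0)}=o_{P_0^*}(1)$. * (A3) $R_n=o_{P_0^*}(n^{-1/2})$. * (B1) There is a class $\mathcal F$ of measurable functions $\mathcal X\to\mathbb R$ (possibly a different one) with $\phi_0\in\mathcal F$ and $P_W^*(\phi_n^*\notin\mathcal F)\xrightarrow{P_0^*}0$ such that, for a $P_0$-Brownian bridge $\mathbb G_0$ in $\ell^\infty(\mathcal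 F)$, $\sup_h|E_W^*h(\mathbb G_n^*)-E\,h(\mathbb G_0)|\xrightarrow{P_0^*}0$, the supremum being over all $1$-Lipschitz $h:\ell^\infty(\mathcal F)\to[-1,1]$. * (B2) $\|\phi_n^*-\phi_0\|_{L_2(P_0)}=o_{P_W^*}(1)$. * (B3) $R_n^*=o_{P_W^*}(n^{-1/2})$. It is part of (A1) and (B1) that, for all large $n$, the processes $\mathbb G_n$ and $\mathbb G_n^*$ are well defined on $\mathcal F$ and almost surely bounded there. **Theorem.** Suppose that (A1)–(A3) and (B1)–(B3) hold and that $T_n^*$ is asymptotically uniformly square-integrable: $$\lim_{m\to\infty}\limsup_{n\to\infty}E_0^*E_W^*\big[T_n^{*2}\,1\{T_n^{*2}\ge m\}\big]=0 .$$ Then the bootstrap variance $\bar\sigma_n^2=E_W^*[T_n^{*2}]$ satisfies $\bar\sigma_n^2\xrightarrow{P_0^*}\sigma_0^2$ and $\bar\sigma_n\xrightarrow{P_0^*}\sigma_0$. If moreover $\sigma_0^2>0$, then for all $\alpha,\beta>0$ with $\alpha+\beta<1$ the bootstrap Wald interval $$\big[\,T(\eta_n,\mathbb P_n)+z_\beta\,\bar\sigma_n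 n^{-1/2},\ T(\eta_n,\mathbb P_n)+z_{1-\alpha}\,\bar\sigma_n n^{-1/2}\,\big],$$ where $z_p$ is the lower $p$-quantile of the standard normal distribution, has asymptotic confidence level $1-\alpha-\beta$: the probability (both outer and inner) that it contains $\psi_0$ tends to $1-\alpha-\beta$. -/

import Mathlib

open MeasureTheory ProbabilityTheory Filter Topology
open scoped ENNReal BoundedContinuousFunction

noncomputable section

/-! ### Outer expectations

The outer probability `P^*(A) = E^* 1_A` of an arbitrary set `A` is the infimum of `P(B)` over the
measurable `B ⊇ A`. This is how a Mathlib measure is evaluated on non-measurable sets, so outer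
probabilities are written `μ A` below. -/

/-- Outer expectation of an arbitrary `[0, ∞]`-valued function: infimum of the integrals of its
almost sure measurable majorants. -/
def outerLIntegral {Ω : Type*} [MeasurableSpace Ω] (μ : Measure Ω) (h : Ω → ℝ≥0∞) : ℝ≥0∞ :=
  sInf {r | ∃ U : Ω → ℝ≥0∞, Measurable U ∧ (∀ᵐ ω ∂μ, h ω ≤ U ω) ∧ r = ∫⁻ ω, U ω ∂μ}

/-- Outer expectation of an arbitrary bounded real function under a probability measure: infimum
of the integrals of its almost sure measurable majorants. (For bounded `h` the constant majorant is
integrable, so that majorants with infinite integral do not matter for the infimum.) It is only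
applied to bounded functions. -/
def outerExp {Ω : Type*} [MeasurableSpace Ω] (μ : Measure Ω) (h : Ω → ℝ) : ℝ :=
  sInf {r | ∃ U : Ω → ℝ, Measurable U ∧ Integrable U μ ∧ (∀ᵐ ω ∂μ, h ω ≤ U ω) ∧
    r = ∫ ω, U ω ∂μ}

/-! ### Modes of convergence

The `n`-th random element lives on its own probability space `(Ω n, μ n)`; the additional
(bootstrap) randomness lives on `(Ω' n, κ n)`. -/

/-- `Y n = o_{P^*}(1)`, for sequences of deviations `Y n ≥ 0` (possibly infinite). -/
def ConvOuterProb {Ω : ℕ → Type*} [∀ n, MeasurableSpace (Ω n)] (μ : ∀ n, Measure (Ω n))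
    (Y : ∀ n, Ω n → ℝ≥0∞) : Prop :=
  ∀ ε : ℝ, 0 < ε → Tendsto (fun n => μ n {ω | ENNReal.ofReal ε ≤ Y n ω}) atTop (𝓝 0)

/-- `Y n = o_{P_W^*}(1)`, for sequences of deviations `Y n ≥ 0`: for every `ε > 0` the conditional
outer probability of `Y n ≥ ε` converges to zero in outer probability. -/
def CondConvOuterProb {Ω Ω' : ℕ → Type*} [∀ n, MeasurableSpace (Ω n)]
    [∀ n, MeasurableSpace (Ω' n)] (μ : ∀ n, Measure (Ω n)) (κ : ∀ n, Measure (Ω' n))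
    (Y : ∀ n, Ω n → Ω' n → ℝ≥0∞) : Prop :=
  ∀ ε : ℝ, 0 < ε → ConvOuterProb μ (fun n x => κ n {w | ENNReal.ofReal ε ≤ Y n x w})

/-- Weak convergence of arbitrary maps `G n` into a metric space to a Borel law `ν`. -/
def OuterWeakConv {Ω : ℕ → Type*} [∀ n, MeasurableSpace (Ω n)] (μ : ∀ n, Measure (Ω n))
    {D : Type*} [PseudoMetricSpace D] [MeasurableSpace D] (G : ∀ n, Ω n → D)
    (ν : Measure D) : Prop :=
  ∀ h : D →ᵇ ℝ, Tendsto (fun n => outerExp (μ n) (fun ω => h (G n ω))) atTop (𝓝 (∫ z, h z ∂ν))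

/-- The functions `h : D → [-1, 1]` that are `1`-Lipschitz. -/
def BL1 (D : Type*) [PseudoMetricSpace D] : Set (D → ℝ) :=
  {h | LipschitzWith 1 h ∧ ∀ z, |h z| ≤ 1}

/-- Conditional weak convergence, in outer probability, of arbitrary maps `G n` into a metric space
to a Borel law `ν`: `sup_{h ∈ BL₁} |E_W^* h(G n) - E h(G)| → 0` in outer probability. -/
def CondOuterWeakConv {Ω Ω' : ℕ → Type*} [∀ n, MeasurableSpace (Ω n)]
    [∀ n, MeasurableSpace (Ω' n)] (μ : ∀ n, Measure (Ω n)) (κ : ∀ n, Measure (Ω' n))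
    {D : Type*} [PseudoMetricSpace D] [MeasurableSpace D] (G : ∀ n, Ω n → Ω' n → D)
    (ν : Measure D) : Prop :=
  ConvOuterProb μ (fun n x => ⨆ h ∈ BL1 D,
    ENNReal.ofReal |outerExp (κ n) (fun w => h (G n x w)) - ∫ z, h z ∂ν|)

/-! ### The space `ℓ^∞(F)` and the Brownian bridge -/

/-- Bounded real functions on the class `F`, with the supremum norm. -/
abbrev EllInf {𝒳 : Type*} (F : Set (𝒳 → ℝ)) : Type _ := lp (fun _ : F => ℝ) ∞

/-- `ℓ^∞(F)` carries its Borel `σ`-algebra. -/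
instance EllInf.measurableSpace {𝒳 : Type*} (F : Set (𝒳 → ℝ)) : MeasurableSpace (EllInf F) :=
  borel _

instance EllInf.borelSpace {𝒳 : Type*} (F : Set (𝒳 → ℝ)) : BorelSpace (EllInf F) := ⟨rfl⟩

open Classical in
/-- A bounded function on `F` as an element of `ℓ^∞(F)` (unbounded functions, which occur with
probability zero wherever this is used, are sent to `0`). -/
def toEllInf {𝒳 : Type*} (F : Set (𝒳 → ℝ)) (z : F → ℝ) : EllInf F :=
  if h : Memℓp (E := fun _ : F => ℝ) z ∞ then ⟨z, h⟩ else 0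

/-- `ν` is the law on `ℓ^∞(F)` of a tight, Borel measurable `P`-Brownian bridge: a Gaussian process
with mean zero and covariance `P(fg) - Pf Pg`, indexed by `F ⊆ L₂(P)`. -/
structure IsBrownianBridge {𝒳 : Type*} [MeasurableSpace 𝒳] (P : Measure 𝒳) (F : Set (𝒳 → ℝ))
    (ν : Measure (EllInf F)) : Prop where
  isProbabilityMeasure : IsProbabilityMeasure ν
  tight : IsTightMeasureSet {ν}
  memLp : ∀ f ∈ F, MemLp f 2 P
  gaussian : IsGaussianProcess (fun (f : F) (z : EllInf F) => z f) ν
  mean : ∀ f : F, ∫ z : EllInf F, z f ∂ν = 0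
  cov : ∀ f g : F, ∫ z : EllInf F, z f * z g ∂ν =
    ∫ x, f.1 x * g.1 x ∂P - (∫ x, f.1 x ∂P) * ∫ x, g.1 x ∂P

/-! ### Empirical measures -/

/-- The empirical measure of a sample. -/
def empMeasure {𝒳 : Type*} [MeasurableSpace 𝒳] {n : ℕ} (x : Fin n → 𝒳) : Measure 𝒳 :=
  (n : ℝ≥0∞)⁻¹ • ∑ i, Measure.dirac (x i)

/-- The integral of `f` against the empirical measure of a sample, i.e. the sample mean of `f`. -/
def empMean {𝒳 : Type*} {n : ℕ} (x : Fin n → 𝒳) (f : 𝒳 → ℝ) : ℝ :=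
  (∑ i, f (x i)) / n

/-! ### The estimation and bootstrap framework -/

/-- The data of the problem. The estimators are arbitrary (possibly non-measurable) functions of
the data. -/
structure BootstrapFramework (𝒳 H : Type*) [MeasurableSpace 𝒳] where
  /-- The distribution of the observations. -/
  P₀ : ProbabilityMeasure 𝒳
  /-- The map that takes a nuisance value and a distribution to a value of the parameter. Only its
  values at `P₀`, at empirical measures and at bootstrap sampling distributions are used, so a map
  defined on a smaller set of distributions may be extended arbitrarily. -/
  T : H → Measure 𝒳 → ℝ
  /-- The true nuisance parameter. -/
  η₀ : H
  /-- The influence function. -/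
  φ₀ : 𝒳 → ℝ
  φ₀_memLp : MemLp φ₀ 2 (P₀ : Measure 𝒳)
  φ₀_mean : ∫ x, φ₀ x ∂(P₀ : Measure 𝒳) = 0
  /-- The nuisance estimator, a function of the data `X₁, …, Xₙ`. -/
  η : ∀ n, (Fin n → 𝒳) → H
  /-- The estimator of the influence function. -/
  φ : ∀ n, (Fin n → 𝒳) → 𝒳 → ℝ
  /-- The spaces of the variables `W_{ni}` that generate the bootstrap sample. -/
  W : ℕ → Type*
  [measW : ∀ n, MeasurableSpace (W n)]
  /-- The distribution of each `W_{ni}`. -/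
  Q : ∀ n, ProbabilityMeasure (W n)
  /-- The bootstrap sample is `X_i^* = γₙ(X₁, …, Xₙ, W_{ni})`. -/
  γ : ∀ n, (Fin n → 𝒳) → W n → 𝒳
  measurable_γ : ∀ n, Measurable (Function.uncurry (γ n))
  /-- The bootstrap nuisance estimator, a function of the data and of the bootstrap sample. -/
  ηs : ∀ n, (Fin n → 𝒳) → (Fin n → 𝒳) → H
  /-- The bootstrap estimator of the influence function. -/
  φs : ∀ n, (Fin n → 𝒳) → (Fin n → 𝒳) → 𝒳 → ℝ

namespace BootstrapFramework

attribute [instance] BootstrapFramework.measW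

variable {𝒳 H : Type*} [MeasurableSpace 𝒳] (B : BootstrapFramework 𝒳 H)

/-- The distribution `P₀ⁿ` of the data. -/
def dataLaw (n : ℕ) : Measure (Fin n → 𝒳) := Measure.pi (fun _ => (B.P₀ : Measure 𝒳))

/-- The distribution `Qₙⁿ` of `(W_{n1}, …, W_{nn})`; the conditional outer expectation and
probability given the data are those under `Qₙⁿ` with the data held fixed. -/
def bootLaw (n : ℕ) : Measure (Fin n → B.W n) := Measure.pi (fun _ => (B.Q n : Measure (B.W n)))

/-- The true value of the parameter. -/
def ψ₀ : ℝ := B.T B.η₀ B.P₀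

/-- The estimator `ψₙ = T(ηₙ, ℙₙ)`. -/
def ψ (n : ℕ) (x : Fin n → 𝒳) : ℝ := B.T (B.η n x) (empMeasure x)

/-- The bootstrap sampling distribution `P̂ₙ`: the conditional law of `X_i^*` given the data. -/
def Phat (n : ℕ) (x : Fin n → 𝒳) : Measure 𝒳 := (B.Q n : Measure (B.W n)).map (B.γ n x)

/-- The bootstrap sample. -/
def bootSample (n : ℕ) (x : Fin n → 𝒳) (w : Fin n → B.W n) : Fin n → 𝒳 := fun i => B.γ n x (w i)

/-- The bootstrap estimator `ψₙ^* = T(ηₙ^*, ℙₙ^*)`. -/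
def ψs (n : ℕ) (x : Fin n → 𝒳) (w : Fin n → B.W n) : ℝ :=
  B.T (B.ηs n x (B.bootSample n x w)) (empMeasure (B.bootSample n x w))

/-- `φₙ^*` as a function of the data and of `(W_{n1}, …, W_{nn})`. -/
def φboot (n : ℕ) (x : Fin n → 𝒳) (w : Fin n → B.W n) : 𝒳 → ℝ := B.φs n x (B.bootSample n x w)

/-- The empirical process `𝔾ₙ f = n^{1/2} (ℙₙ - P₀) f`. -/
def empProc (n : ℕ) (x : Fin n → 𝒳) (f : 𝒳 → ℝ) : ℝ :=
  √(n : ℝ) * (empMean x f - ∫ y, f y ∂(B.P₀ : Measure 𝒳))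

/-- The bootstrap empirical process `𝔾ₙ^* f = n^{1/2} (ℙₙ^* - P̂ₙ) f`. -/
def bootProc (n : ℕ) (x : Fin n → 𝒳) (w : Fin n → B.W n) (f : 𝒳 → ℝ) : ℝ :=
  √(n : ℝ) * (empMean (B.bootSample n x w) f - ∫ y, f y ∂(B.Phat n x))

/-- The remainder `Rₙ = T(ηₙ, ℙₙ) - T(η₀, P₀) - (ℙₙ - P₀) φₙ`. -/
def R (n : ℕ) (x : Fin n → 𝒳) : ℝ :=
  B.ψ n x - B.ψ₀ - (empMean x (B.φ n x) - ∫ y, B.φ n x y ∂(B.P₀ : Measure 𝒳))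

/-- The remainder `Rₙ^* = T(ηₙ^*, ℙₙ^*) - T(ηₙ, P̂ₙ) - (ℙₙ^* - P̂ₙ) φₙ^*`. -/
def Rs (n : ℕ) (x : Fin n → 𝒳) (w : Fin n → B.W n) : ℝ :=
  B.ψs n x w - B.T (B.η n x) (B.Phat n x) -
    (empMean (B.bootSample n x w) (B.φboot n x w) - ∫ y, B.φboot n x w y ∂(B.Phat n x))

/-- (A1): for a class `F ∋ φ₀` of measurable functions, `φₙ ∈ F` with probability tending to one
(the outer probability of `φₙ ∉ F` tends to zero) and `𝔾ₙ ⇝ 𝔾₀` in `ℓ^∞(F)`, with `𝔾₀` a `P₀`-Brownian bridge. -/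
def CondA1 : Prop :=
  ∃ F : Set (𝒳 → ℝ), (∀ f ∈ F, Measurable f) ∧ B.φ₀ ∈ F ∧
    Tendsto (fun n => B.dataLaw n {x | B.φ n x ∉ F}) atTop (𝓝 0) ∧
    (∀ᶠ n in atTop, ∀ᵐ x ∂(B.dataLaw n),
      Memℓp (E := fun _ : F => ℝ) (fun f : F => B.empProc n x f) ∞) ∧
    ∃ ν : Measure (EllInf F), IsBrownianBridge (B.P₀ : Measure 𝒳) F ν ∧
      OuterWeakConv B.dataLaw (fun n x => toEllInf F (fun f : F => B.empProc n x f)) ν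

/-- (A2): `‖φₙ - φ₀‖_{L₂(P₀)} = o_{P₀^*}(1)`. -/
def CondA2 : Prop :=
  ConvOuterProb B.dataLaw (fun n x => eLpNorm (B.φ n x - B.φ₀) 2 (B.P₀ : Measure 𝒳))

/-- (A3): `Rₙ = o_{P₀^*}(n^{-1/2})`. -/
def CondA3 : Prop :=
  ConvOuterProb B.dataLaw (fun n x => ENNReal.ofReal |√(n : ℝ) * B.R n x|)

/-- (B1): for a class `F ∋ φ₀` of measurable functions, the conditional probability of `φₙ^* ∈ F`
tends to one in outer probability (the conditional outer probability of `φₙ^* ∉ F` tends to zero in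
outer probability) and `𝔾ₙ^*` converges weakly to a `P₀`-Brownian bridge in
`ℓ^∞(F)`, conditionally on the data, in outer probability. -/
def CondB1 : Prop :=
  ∃ F : Set (𝒳 → ℝ), (∀ f ∈ F, Measurable f) ∧ B.φ₀ ∈ F ∧
    ConvOuterProb B.dataLaw (fun n x => B.bootLaw n {w | B.φboot n x w ∉ F}) ∧
    (∀ᶠ n in atTop, ∀ᵐ x ∂(B.dataLaw n), (∀ f ∈ F, Integrable f (B.Phat n x)) ∧
      ∀ᵐ w ∂(B.bootLaw n),
        Memℓp (E := fun _ : F => ℝ) (fun f : F => B.bootProc n x w f) ∞) ∧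
    ∃ ν : Measure (EllInf F), IsBrownianBridge (B.P₀ : Measure 𝒳) F ν ∧
      CondOuterWeakConv B.dataLaw B.bootLaw
        (fun n x w => toEllInf F (fun f : F => B.bootProc n x w f)) ν

/-- (B2): `‖φₙ^* - φ₀‖_{L₂(P₀)} = o_{P_W^*}(1)`. -/
def CondB2 : Prop :=
  CondConvOuterProb B.dataLaw B.bootLaw
    (fun n x w => eLpNorm (B.φboot n x w - B.φ₀) 2 (B.P₀ : Measure 𝒳))

/-- (B3): `Rₙ^* = o_{P_W^*}(n^{-1/2})`. -/
def CondB3 : Prop :=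
  CondConvOuterProb B.dataLaw B.bootLaw
    (fun n x w => ENNReal.ofReal |√(n : ℝ) * B.Rs n x w|)

/-- `Tₙ^* = n^{1/2} [T(ηₙ^*, ℙₙ^*) - T(ηₙ, P̂ₙ)]`. -/
def Tstar (n : ℕ) (x : Fin n → 𝒳) (w : Fin n → B.W n) : ℝ :=
  √(n : ℝ) * (B.ψs n x w - B.T (B.η n x) (B.Phat n x))

/-- Asymptotic uniform square-integrability of `Tₙ^*`:
`lim_{m → ∞} limsup_{n → ∞} E₀^* E_W^* [Tₙ^{*2} 1{Tₙ^{*2} ≥ m}] = 0`. -/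
def AsympUnifSqIntegrable : Prop :=
  Tendsto (fun m : ℕ => limsup (fun n : ℕ =>
    outerLIntegral (B.dataLaw n) (fun x => outerLIntegral (B.bootLaw n)
      ({w | (m : ℝ) ≤ B.Tstar n x w ^ 2}.indicator
        (fun w => ENNReal.ofReal (B.Tstar n x w ^ 2))))) atTop) atTop (𝓝 0)

/-- The asymptotic variance `σ₀² = P₀ φ₀²`. -/
def σ₀sq : ℝ := ∫ y, B.φ₀ y ^ 2 ∂(B.P₀ : Measure 𝒳)

/-- The bootstrap variance `σ̄ₙ² = E_W^* [Tₙ^{*2}]`. It may be infinite for some data. -/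
def σbarsq (n : ℕ) (x : Fin n → 𝒳) : ℝ≥0∞ :=
  outerLIntegral (B.bootLaw n) (fun w => ENNReal.ofReal (B.Tstar n x w ^ 2))

/-- The bootstrap standard deviation `σ̄ₙ`. -/
def σbar (n : ℕ) (x : Fin n → 𝒳) : ℝ≥0∞ := B.σbarsq n x ^ (1 / 2 : ℝ)

end BootstrapFramework

/-- The distance `|a - b|` of two elements of `[0, ∞]`, through truncated subtraction. -/
def absDiff (a b : ℝ≥0∞) : ℝ≥0∞ := (a - b) + (b - a)

/-- The lower `p`-quantile of the standard normal distribution. -/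
def normalQuantile (p : ℝ) : ℝ := sInf {z : ℝ | p ≤ cdf (gaussianReal 0 1) z}

/-- The bootstrap Wald interval
`[ψₙ + z_β σ̄ₙ n^{-1/2}, ψₙ + z_{1-α} σ̄ₙ n^{-1/2}]`, with endpoints in `[-∞, ∞]`. -/
def BootstrapFramework.waldInterval {𝒳 H : Type*} [MeasurableSpace 𝒳]
    (B : BootstrapFramework 𝒳 H) (α β : ℝ) (n : ℕ) (x : Fin n → 𝒳) : Set ℝ :=
  {t : ℝ |
    (B.ψ n x : EReal) + (normalQuantile β : EReal) * (B.σbar n x : EReal) /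
      ((√(n : ℝ) : ℝ) : EReal) ≤ (t : EReal) ∧
    (t : EReal) ≤ (B.ψ n x : EReal) + (normalQuantile (1 - α) : EReal) * (B.σbar n x : EReal) /
      ((√(n : ℝ) : ℝ) : EReal)}

end

/-! Almost every path of a tight Brownian bridge is uniformly continuous for the `L₂(P₀)`-seminorm,
so the local oscillation of the bridge at `φ₀` is small. Weak convergence transfers this to `𝔾ₙ`
and, conditionally on the data, to `𝔾ₙ^*`, which allows the estimated influence functions to be
replaced by `φ₀`: both `n^{1/2} (ψₙ - ψ₀) - 𝔾ₙ φ₀` and `Tₙ^* - 𝔾ₙ^* φ₀` are asymptotically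
negligible.

Conditional weak convergence gives the limits of the truncated second moments of `𝔾ₙ^* φ₀`, hence of
`Tₙ^*`, and uniform square-integrability removes the truncation.

The event that the Wald interval contains `ψ₀` then differs from the measurable event
`-𝔾ₙ φ₀ ∈ [z_β σ₀, z_{1-α} σ₀]` by a set of vanishing outer probability, which controls outer and
inner probabilities at once. -/

section OuterIntegral

variable {Ω : Type*} [MeasurableSpace Ω] {μ : Measure Ω}

theorem outerLIntegral_mono_ae {h h' : Ω → ℝ≥0∞} (hle : ∀ᵐ ω ∂μ, h ω ≤ h' ω) :
    outerLIntegral μ h ≤ outerLIntegral μ h' := by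
  refine le_sInf ?_
  rintro _ ⟨U, hU, hU_ge, rfl⟩
  exact sInf_le ⟨U, hU, by filter_upwards [hle, hU_ge] with ω h₁ h₂ using h₁.trans h₂, rfl⟩

theorem outerLIntegral_mono {h h' : Ω → ℝ≥0∞} (hle : ∀ ω, h ω ≤ h' ω) :
    outerLIntegral μ h ≤ outerLIntegral μ h' :=
  outerLIntegral_mono_ae (Eventually.of_forall hle)

theorem outerLIntegral_congr_ae {h h' : Ω → ℝ≥0∞} (heq : h =ᵐ[μ] h') :
    outerLIntegral μ h = outerLIntegral μ h' :=
  le_antisymm (outerLIntegral_mono_ae heq.le) (outerLIntegral_mono_ae heq.symm.le)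

theorem outerLIntegral_eq_lintegral {h : Ω → ℝ≥0∞} (hm : Measurable h) :
    outerLIntegral μ h = ∫⁻ ω, h ω ∂μ := by
  refine le_antisymm (sInf_le ⟨h, hm, Eventually.of_forall fun _ => le_rfl, rfl⟩) (le_sInf ?_)
  rintro _ ⟨U, -, hU_ge, rfl⟩
  exact lintegral_mono_ae hU_ge

theorem outerLIntegral_const [IsProbabilityMeasure μ] (c : ℝ≥0∞) :
    outerLIntegral μ (fun _ => c) = c := by
  rw [outerLIntegral_eq_lintegral measurable_const]
  simp

theorem outerLIntegral_add_le (h h' : Ω → ℝ≥0∞) :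
    outerLIntegral μ (fun ω => h ω + h' ω) ≤ outerLIntegral μ h + outerLIntegral μ h' := by
  unfold outerLIntegral
  rw [ENNReal.sInf_add]
  refine le_iInf₂ ?_
  rintro _ ⟨U, hU, hU_ge, rfl⟩
  rw [ENNReal.add_sInf]
  refine le_iInf₂ ?_
  rintro _ ⟨V, hV, hV_ge, rfl⟩
  refine sInf_le ⟨fun ω => U ω + V ω, hU.add hV, ?_, (lintegral_add_left hU V).symm⟩
  filter_upwards [hU_ge, hV_ge] with ω h₁ h₂ using add_le_add h₁ h₂

theorem outerLIntegral_const_mul_le (h : Ω → ℝ≥0∞) {c : ℝ≥0∞} (hc : c ≠ 0) (hc' : c ≠ ∞) :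
    outerLIntegral μ (fun ω => c * h ω) ≤ c * outerLIntegral μ h := by
  rw [mul_comm c (outerLIntegral μ h), ← ENNReal.div_le_iff_le_mul (.inl hc) (.inl hc')]
  refine le_sInf ?_
  rintro _ ⟨U, hU, hU_ge, rfl⟩
  rw [ENNReal.div_le_iff_le_mul (.inl hc) (.inl hc'), mul_comm, ← lintegral_const_mul c hU]
  exact sInf_le ⟨_, hU.const_mul c, hU_ge.mono fun ω hω => mul_le_mul' le_rfl hω, rfl⟩

theorem outerLIntegral_const_mul (h : Ω → ℝ≥0∞) {c : ℝ≥0∞} (hc : c ≠ 0) (hc' : c ≠ ∞) :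
    outerLIntegral μ (fun ω => c * h ω) = c * outerLIntegral μ h := by
  refine le_antisymm (outerLIntegral_const_mul_le h hc hc') ?_
  have hinv := outerLIntegral_const_mul_le (μ := μ) (fun ω => c * h ω)
    (ENNReal.inv_ne_zero.2 hc') (ENNReal.inv_ne_top.2 hc)
  simp only [← mul_assoc, ENNReal.inv_mul_cancel hc hc', one_mul] at hinv
  calc c * outerLIntegral μ h ≤ c * (c⁻¹ * outerLIntegral μ fun ω => c * h ω) := by gcongr
    _ = outerLIntegral μ fun ω => c * h ω := by
        rw [← mul_assoc, ENNReal.mul_inv_cancel hc hc', one_mul]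

theorem outerLIntegral_indicator_const_le (s : Set Ω) (c : ℝ≥0∞) :
    outerLIntegral μ (s.indicator fun _ => c) ≤ c * μ s := by
  refine sInf_le ⟨(toMeasurable μ s).indicator fun _ => c,
    measurable_const.indicator (measurableSet_toMeasurable μ s), ?_, ?_⟩
  · exact Eventually.of_forall
      fun ω => Set.indicator_le_indicator_of_subset (subset_toMeasurable μ s) (by simp) ω
  · rw [lintegral_indicator_const (measurableSet_toMeasurable μ s), measure_toMeasurable]

theorem mul_measure_ge_le_outerLIntegral (h : Ω → ℝ≥0∞) (c : ℝ≥0∞) :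
    c * μ {ω | c ≤ h ω} ≤ outerLIntegral μ h := by
  refine le_sInf ?_
  rintro _ ⟨U, hU, hU_ge, rfl⟩
  refine le_trans ?_ (mul_meas_ge_le_lintegral hU c)
  gcongr c * ?_
  refine measure_mono_ae ?_
  filter_upwards [hU_ge] with ω h₁ h₂ using le_trans h₂ h₁

theorem measure_ge_le_inv_mul_outerLIntegral (h : Ω → ℝ≥0∞) {c : ℝ≥0∞} (hc : c ≠ 0)
    (hc' : c ≠ ∞) : μ {ω | c ≤ h ω} ≤ c⁻¹ * outerLIntegral μ h := by
  rw [mul_comm, ← div_eq_mul_inv, ENNReal.le_div_iff_mul_le (.inl hc) (.inl hc'), mul_comm]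
  exact mul_measure_ge_le_outerLIntegral h c

theorem outerLIntegral_le_add_mul_measure [IsProbabilityMeasure μ] {h : Ω → ℝ≥0∞} {M : ℝ≥0∞}
    (hM : ∀ ω, h ω ≤ M) (c : ℝ≥0∞) : outerLIntegral μ h ≤ c + M * μ {ω | c ≤ h ω} := by
  have hsplit : ∀ ω, h ω ≤ c + {ω | c ≤ h ω}.indicator (fun _ => M) ω := by
    intro ω
    by_cases hω : ω ∈ {ω | c ≤ h ω}
    · rw [Set.indicator_of_mem hω]
      exact le_add_left (hM ω)
    · exact le_add_right (not_le.1 hω).le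
  calc outerLIntegral μ h
      ≤ outerLIntegral μ (fun _ => c) + outerLIntegral μ ({ω | c ≤ h ω}.indicator fun _ => M) :=
        (outerLIntegral_mono hsplit).trans (outerLIntegral_add_le _ _)
    _ ≤ c + M * μ {ω | c ≤ h ω} :=
        add_le_add (outerLIntegral_const c).le (outerLIntegral_indicator_const_le _ _)

theorem outerExp_le_integral {h U : Ω → ℝ} (h0 : ∀ ω, 0 ≤ h ω) (hU : Measurable U)
    (hUi : Integrable U μ) (hU_ge : ∀ᵐ ω ∂μ, h ω ≤ U ω) : outerExp μ h ≤ ∫ ω, U ω ∂μ := by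
  refine csInf_le ⟨0, ?_⟩ ⟨U, hU, hUi, hU_ge, rfl⟩
  rintro _ ⟨V, -, -, hV_ge, rfl⟩
  exact integral_nonneg_of_ae (hV_ge.mono fun ω hω => (h0 ω).trans hω)

theorem le_outerExp [IsFiniteMeasure μ] {h : Ω → ℝ} {M a : ℝ} (hM : ∀ ω, h ω ≤ M)
    (ha : ∀ U : Ω → ℝ, Measurable U → Integrable U μ → (∀ᵐ ω ∂μ, h ω ≤ U ω) → a ≤ ∫ ω, U ω ∂μ) :
    a ≤ outerExp μ h := by
  refine le_csInf
    ⟨_, fun _ => M, measurable_const, integrable_const _, Eventually.of_forall hM, rfl⟩ ?_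
  rintro _ ⟨U, hU, hUi, hU_ge, rfl⟩
  exact ha U hU hUi hU_ge

theorem outerLIntegral_le_ofReal_outerExp [IsProbabilityMeasure μ] {h : Ω → ℝ} {M : ℝ}
    (h0 : ∀ ω, 0 ≤ h ω) (hM : ∀ ω, h ω ≤ M) :
    outerLIntegral μ (fun ω => ENNReal.ofReal (h ω)) ≤ ENNReal.ofReal (outerExp μ h) := by
  have hfin : outerLIntegral μ (fun ω => ENNReal.ofReal (h ω)) ≠ ∞ :=
    ne_top_of_le_ne_top ENNReal.ofReal_ne_top
      ((outerLIntegral_mono fun ω => ENNReal.ofReal_le_ofReal (hM ω)).trans_eq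
        (outerLIntegral_const _))
  refine (ENNReal.le_ofReal_iff_toReal_le hfin ?_).2 (le_outerExp hM fun U hU hUi hU_ge => ?_)
  · exact le_outerExp hM fun U _ _ hU_ge =>
      integral_nonneg_of_ae (hU_ge.mono fun ω hω => (h0 ω).trans hω)
  have hU0 : 0 ≤ᵐ[μ] U := hU_ge.mono fun ω hω => (h0 ω).trans hω
  refine ENNReal.toReal_le_of_le_ofReal (integral_nonneg_of_ae hU0) ?_
  rw [ofReal_integral_eq_lintegral_ofReal hUi hU0, ← outerLIntegral_eq_lintegral hU.ennreal_ofReal]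
  exact outerLIntegral_mono_ae (hU_ge.mono fun ω hω => ENNReal.ofReal_le_ofReal hω)

theorem ofReal_outerExp_le_outerLIntegral [IsFiniteMeasure μ] {h : Ω → ℝ} {M : ℝ}
    (h0 : ∀ ω, 0 ≤ h ω) (hM : ∀ ω, h ω ≤ M) :
    ENNReal.ofReal (outerExp μ h) ≤ outerLIntegral μ (fun ω => ENNReal.ofReal (h ω)) := by
  refine le_sInf ?_
  rintro _ ⟨U, hU, hU_ge, rfl⟩
  have hfin : ∀ ω, min (U ω) (ENNReal.ofReal M) ≠ ∞ := fun ω =>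
    ne_top_of_le_ne_top ENNReal.ofReal_ne_top (min_le_right _ _)
  have hVm : Measurable fun ω => (min (U ω) (ENNReal.ofReal M)).toReal :=
    (hU.min measurable_const).ennreal_toReal
  have hVi : Integrable (fun ω => (min (U ω) (ENNReal.ofReal M)).toReal) μ :=
    Integrable.of_bound hVm.aestronglyMeasurable (ENNReal.ofReal M).toReal
      (Eventually.of_forall fun ω => by
        rw [Real.norm_of_nonneg ENNReal.toReal_nonneg]
        exact ENNReal.toReal_mono ENNReal.ofReal_ne_top (min_le_right _ _))
  have hV_ge : ∀ᵐ ω ∂μ, h ω ≤ (min (U ω) (ENNReal.ofReal M)).toReal := by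
    filter_upwards [hU_ge] with ω hω
    rw [← ENNReal.ofReal_le_iff_le_toReal (hfin ω)]
    exact le_min hω (ENNReal.ofReal_le_ofReal (hM ω))
  calc ENNReal.ofReal (outerExp μ h)
      ≤ ENNReal.ofReal (∫ ω, (min (U ω) (ENNReal.ofReal M)).toReal ∂μ) :=
        ENNReal.ofReal_le_ofReal (outerExp_le_integral h0 hVm hVi hV_ge)
    _ = ∫⁻ ω, min (U ω) (ENNReal.ofReal M) ∂μ := by
        rw [ofReal_integral_eq_lintegral_ofReal hVi
          (Eventually.of_forall fun _ => ENNReal.toReal_nonneg)]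
        exact lintegral_congr fun ω => ENNReal.ofReal_toReal (hfin ω)
    _ ≤ ∫⁻ ω, U ω ∂μ := lintegral_mono fun ω => min_le_left _ _

theorem ofReal_outerExp [IsProbabilityMeasure μ] {h : Ω → ℝ} {M : ℝ} (h0 : ∀ ω, 0 ≤ h ω)
    (hM : ∀ ω, h ω ≤ M) :
    ENNReal.ofReal (outerExp μ h) = outerLIntegral μ (fun ω => ENNReal.ofReal (h ω)) :=
  le_antisymm (ofReal_outerExp_le_outerLIntegral h0 hM) (outerLIntegral_le_ofReal_outerExp h0 hM)

theorem outerExp_congr_ae {h h' : Ω → ℝ} (heq : h =ᵐ[μ] h') :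
    outerExp μ h = outerExp μ h' := by
  have hiff (U : Ω → ℝ) : (∀ᵐ ω ∂μ, h ω ≤ U ω) ↔ ∀ᵐ ω ∂μ, h' ω ≤ U ω :=
    eventually_congr (heq.mono fun ω hω => by rw [hω])
  simp only [outerExp, hiff]

theorem outerExp_eq_integral {h : Ω → ℝ} (hi : Integrable h μ) :
    outerExp μ h = ∫ ω, h ω ∂μ := by
  obtain ⟨g, hg, hhg⟩ := hi.aestronglyMeasurable
  refine IsLeast.csInf_eq
    ⟨⟨g, hg.measurable, hi.congr hhg, hhg.le, integral_congr_ae hhg⟩, ?_⟩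
  rintro _ ⟨U, -, hUi, hU_ge, rfl⟩
  exact integral_mono_ae hi hUi hU_ge

end OuterIntegral

section Convergence

theorem tendsto_zero_of_le_add_of_limsup {ι : Type*} {l : Filter ι} [l.NeBot] {y : ℕ → ℝ≥0∞}
    {u v : ι → ℕ → ℝ≥0∞} (hu : ∀ᶠ i in l, Tendsto (u i) atTop (𝓝 0))
    (hv : Tendsto (fun i => limsup (v i) atTop) l (𝓝 0))
    (hle : ∀ᶠ i in l, ∀ᶠ n in atTop, y n ≤ u i n + v i n) : Tendsto y atTop (𝓝 0) := by
  refine ENNReal.tendsto_nhds_zero.2 fun ε hε => ?_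
  have hε2 : 0 < ε / 2 := ENNReal.half_pos hε.ne'
  obtain ⟨i, hui, hvi, hi⟩ := (hu.and ((hv.eventually (gt_mem_nhds hε2)).and hle)).exists
  filter_upwards [ENNReal.tendsto_nhds_zero.1 hui _ hε2, eventually_lt_of_limsup_lt hvi, hi]
    with n hun hvn hn
  exact hn.trans ((add_le_add hun hvn.le).trans_eq (ENNReal.add_halves ε))

theorem tendsto_ofReal_nhdsGT_zero : Tendsto ENNReal.ofReal (𝓝[>] 0) (𝓝 0) := by
  simpa using (ENNReal.continuous_ofReal.tendsto 0).mono_left nhdsWithin_le_nhds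

theorem measure_ofReal_le_add_le {Ω : Type*} [MeasurableSpace Ω] (μ : Measure Ω)
    (Y Z : Ω → ℝ≥0∞) (ε : ℝ) :
    μ {ω | ENNReal.ofReal ε ≤ Y ω + Z ω} ≤
      μ {ω | ENNReal.ofReal (ε / 2) ≤ Y ω} + μ {ω | ENNReal.ofReal (ε / 2) ≤ Z ω} := by
  refine (measure_mono fun ω hω => ?_).trans (measure_union_le _ _)
  by_contra hlt
  obtain ⟨hY, hZ⟩ := not_or.1 hlt
  refine (lt_irrefl (ENNReal.ofReal ε)) (lt_of_le_of_lt hω ?_)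
  calc Y ω + Z ω < ENNReal.ofReal (ε / 2) + ENNReal.ofReal (ε / 2) :=
        ENNReal.add_lt_add (not_le.1 hY) (not_le.1 hZ)
    _ = ENNReal.ofReal ε := by
        rw [← two_mul, ← ENNReal.ofReal_ofNat 2, ← ENNReal.ofReal_mul zero_le_two]
        congr 1
        ring

theorem ofReal_le_mul_iff {ε : ℝ} {c y : ℝ≥0∞} (hc0 : c ≠ 0) (hc : c ≠ ∞) :
    ENNReal.ofReal ε ≤ c * y ↔ ENNReal.ofReal (ε / c.toReal) ≤ y := by
  rw [ENNReal.ofReal_div_of_pos (ENNReal.toReal_pos hc0 hc), ENNReal.ofReal_toReal hc,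
    ENNReal.div_le_iff_le_mul (.inl hc0) (.inl hc), mul_comm]

variable {Ω Ω' : ℕ → Type*} [∀ n, MeasurableSpace (Ω n)] [∀ n, MeasurableSpace (Ω' n)]
  {μ : ∀ n, Measure (Ω n)} {κ : ∀ n, Measure (Ω' n)}

namespace ConvOuterProb

variable {Y Z : ∀ n, Ω n → ℝ≥0∞}

theorem mono (hZ : ConvOuterProb μ Z) (hYZ : ∀ᶠ n in atTop, ∀ᵐ x ∂(μ n), Y n x ≤ Z n x) :
    ConvOuterProb μ Y := fun ε hε =>
  tendsto_of_tendsto_of_tendsto_of_le_of_le' tendsto_const_nhds (hZ ε hε)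
    (Eventually.of_forall fun _ => zero_le)
    (hYZ.mono fun _ hn => measure_mono_ae (hn.mono fun _ hx hε => le_trans hε hx))

theorem of_le_add {ι : Type*} {l : Filter ι} [l.NeBot] {U V : ι → ∀ n, Ω n → ℝ≥0∞}
    (hU : ∀ᶠ i in l, ConvOuterProb μ (U i))
    (hV : Tendsto (fun i => limsup (fun n => outerLIntegral (μ n) (V i n)) atTop) l (𝓝 0))
    (hle : ∀ᶠ i in l, ∀ᶠ n in atTop, ∀ᵐ x ∂(μ n), Y n x ≤ U i n x + V i n x) :
    ConvOuterProb μ Y := by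
  intro ε hε
  have hc : ENNReal.ofReal (ε / 2) ≠ 0 := by simpa using hε
  refine tendsto_zero_of_le_add_of_limsup
    (u := fun i n => μ n {x | ENNReal.ofReal (ε / 2) ≤ U i n x})
    (v := fun i n => (ENNReal.ofReal (ε / 2))⁻¹ * outerLIntegral (μ n) (V i n))
    (hU.mono fun i hi => hi (ε / 2) (half_pos hε)) ?_ (hle.mono fun i hi => hi.mono fun n hn => ?_)
  · simp_rw [ENNReal.limsup_const_mul_of_ne_top (ENNReal.inv_ne_top.2 hc)]
    simpa using ENNReal.Tendsto.const_mul hV (.inr (ENNReal.inv_ne_top.2 hc))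
  · calc μ n {x | ENNReal.ofReal ε ≤ Y n x}
        ≤ μ n {x | ENNReal.ofReal ε ≤ U i n x + V i n x} :=
          measure_mono_ae (hn.mono fun x hx hε => le_trans hε hx)
      _ ≤ _ := measure_ofReal_le_add_le _ _ _ _
      _ ≤ _ := add_le_add le_rfl
          (measure_ge_le_inv_mul_outerLIntegral _ hc ENNReal.ofReal_ne_top)

theorem add (hY : ConvOuterProb μ Y) (hZ : ConvOuterProb μ Z) :
    ConvOuterProb μ (fun n x => Y n x + Z n x) := fun ε hε =>
  tendsto_of_tendsto_of_tendsto_of_le_of_le tendsto_const_nhds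
    (by simpa using (hY (ε / 2) (half_pos hε)).add (hZ (ε / 2) (half_pos hε)))
    (fun _ => zero_le) fun n => measure_ofReal_le_add_le (μ n) (Y n) (Z n) ε

theorem const_mul (hY : ConvOuterProb μ Y) {c : ℝ≥0∞} (hc : c ≠ ∞) :
    ConvOuterProb μ (fun n x => c * Y n x) := by
  intro ε hε
  rcases eq_or_ne c 0 with rfl | hc0
  · simp [hε.not_ge]
  simpa only [ofReal_le_mul_iff hc0 hc] using
    hY (ε / c.toReal) (div_pos hε (ENNReal.toReal_pos hc0 hc))

theorem rpow (hY : ConvOuterProb μ Y) {r : ℝ} (hr : 0 < r) :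
    ConvOuterProb μ (fun n x => Y n x ^ r) := by
  intro ε hε
  refine (hY (ε ^ r⁻¹) (Real.rpow_pos_of_pos hε _)).congr fun n =>
    congrArg (μ n) (Set.ext fun x => ?_)
  change ENNReal.ofReal (ε ^ r⁻¹) ≤ Y n x ↔ ENNReal.ofReal ε ≤ Y n x ^ r
  rw [← ENNReal.ofReal_rpow_of_pos hε, ENNReal.rpow_inv_le_iff hr]

end ConvOuterProb

theorem convOuterProb_dirac_unit {y : ℕ → ℝ≥0∞} :
    ConvOuterProb (fun _ => Measure.dirac ()) (fun n (_ : Unit) => y n) ↔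
      Tendsto y atTop (𝓝 0) := by
  refine ⟨fun h => tendsto_order.2 ⟨fun a ha => absurd ha not_lt_zero, fun a ha => ?_⟩,
    fun h ε hε => ?_⟩
  · obtain ⟨ε, -, hε, hεa⟩ := ENNReal.lt_iff_exists_real_btwn.1 ha
    filter_upwards [(h ε (ENNReal.ofReal_pos.1 hε)).eventually (gt_mem_nhds zero_lt_one)]
      with n hn
    refine lt_of_not_ge fun hle => hn.ne ?_
    simp [hεa.le.trans hle]
  · refine tendsto_const_nhds.congr' ?_
    filter_upwards [h.eventually (gt_mem_nhds (ENNReal.ofReal_pos.2 hε))] with n hn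
    simp [hn.not_ge]

namespace CondConvOuterProb

variable {Y Z : ∀ n, Ω n → Ω' n → ℝ≥0∞}

theorem mono (hZ : CondConvOuterProb μ κ Z)
    (hYZ : ∀ᶠ n in atTop, ∀ᵐ x ∂(μ n), ∀ᵐ w ∂(κ n), Y n x w ≤ Z n x w) :
    CondConvOuterProb μ κ Y := fun ε hε =>
  (hZ ε hε).mono (hYZ.mono fun _ hn => hn.mono fun _ hx =>
    measure_mono_ae (hx.mono fun _ hw hε => le_trans hε hw))

theorem add (hY : CondConvOuterProb μ κ Y) (hZ : CondConvOuterProb μ κ Z) :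
    CondConvOuterProb μ κ (fun n x w => Y n x w + Z n x w) := fun ε hε =>
  ((hY (ε / 2) (half_pos hε)).add (hZ (ε / 2) (half_pos hε))).mono
    (Eventually.of_forall fun n => Eventually.of_forall fun x =>
      measure_ofReal_le_add_le (κ n) (Y n x) (Z n x) ε)

theorem const_mul (hY : CondConvOuterProb μ κ Y) {c : ℝ≥0∞} (hc : c ≠ ∞) :
    CondConvOuterProb μ κ (fun n x w => c * Y n x w) := by
  intro ε hε
  rcases eq_or_ne c 0 with rfl | hc0
  · intro θ hθ
    simp [hε.not_ge, hθ.not_ge]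
  simpa only [ofReal_le_mul_iff hc0 hc] using
    hY (ε / c.toReal) (div_pos hε (ENNReal.toReal_pos hc0 hc))

theorem convOuterProb_outerLIntegral [∀ n, IsProbabilityMeasure (μ n)]
    [∀ n, IsProbabilityMeasure (κ n)] (hY : CondConvOuterProb μ κ Y) {M : ℝ≥0∞} (hM : M ≠ ∞)
    (hYM : ∀ n x w, Y n x w ≤ M) :
    ConvOuterProb μ (fun n x => outerLIntegral (κ n) (Y n x)) := by
  refine ConvOuterProb.of_le_add (l := 𝓝[>] (0 : ℝ))
    (U := fun δ n x => M * κ n {w | ENNReal.ofReal δ ≤ Y n x w})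
    (V := fun δ _ _ => ENNReal.ofReal δ) ?_ ?_ ?_
  · filter_upwards [self_mem_nhdsWithin] with δ hδ using (hY δ hδ).const_mul hM
  · simpa only [outerLIntegral_const, limsup_const] using tendsto_ofReal_nhdsGT_zero
  · refine .of_forall fun δ => .of_forall fun n => .of_forall fun x => ?_
    rw [add_comm]
    exact outerLIntegral_le_add_mul_measure (hYM n x) _

end CondConvOuterProb

end Convergence

section AbsDiff

theorem absDiff_comm (a b : ℝ≥0∞) : absDiff a b = absDiff b a :=
  add_comm _ _

theorem absDiff_le {a b d : ℝ≥0∞} (hab : a ≤ b + d) (hba : b ≤ a + d) : absDiff a b ≤ d := by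
  rcases le_total a b with h | h
  · rw [absDiff, tsub_eq_zero_of_le h, zero_add]
    exact tsub_le_iff_left.2 hba
  · rw [absDiff, tsub_eq_zero_of_le h, add_zero]
    exact tsub_le_iff_left.2 hab

theorem le_add_absDiff (a b : ℝ≥0∞) : a ≤ b + absDiff a b :=
  tsub_le_iff_left.1 le_self_add

theorem le_add_absDiff' (a b : ℝ≥0∞) : b ≤ a + absDiff a b :=
  absDiff_comm a b ▸ le_add_absDiff b a

theorem absDiff_mul_le (c a b : ℝ≥0∞) : absDiff (c * a) (c * b) ≤ c * absDiff a b := by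
  refine absDiff_le ?_ ?_ <;> rw [← mul_add] <;> gcongr
  exacts [le_add_absDiff a b, le_add_absDiff' a b]

theorem absDiff_triangle (a b c : ℝ≥0∞) : absDiff a c ≤ absDiff a b + absDiff b c := by
  refine absDiff_le ?_ ?_
  · calc a ≤ b + absDiff a b := le_add_absDiff a b
      _ ≤ c + absDiff b c + absDiff a b := by gcongr; exact le_add_absDiff b c
      _ = c + (absDiff a b + absDiff b c) := by ring
  · calc c ≤ b + absDiff b c := le_add_absDiff' b c
      _ ≤ a + absDiff a b + absDiff b c := by gcongr; exact le_add_absDiff' a b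
      _ = a + (absDiff a b + absDiff b c) := add_assoc _ _ _

theorem ofReal_le_ofReal_add_ofReal_abs_sub (a b : ℝ) :
    ENNReal.ofReal a ≤ ENNReal.ofReal b + ENNReal.ofReal |a - b| :=
  (ENNReal.ofReal_le_ofReal (by linarith [le_abs_self (a - b)])).trans ENNReal.ofReal_add_le

theorem absDiff_ofReal_le (a b : ℝ) :
    absDiff (ENNReal.ofReal a) (ENNReal.ofReal b) ≤ ENNReal.ofReal |a - b| :=
  absDiff_le (ofReal_le_ofReal_add_ofReal_abs_sub a b)
    (abs_sub_comm a b ▸ ofReal_le_ofReal_add_ofReal_abs_sub b a)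

theorem ofReal_abs_toReal_sub_le (a : ℝ≥0∞) {b : ℝ} (hb : 0 ≤ b) :
    ENNReal.ofReal |a.toReal - b| ≤ absDiff a (ENNReal.ofReal b) := by
  induction a with
  | top => simp [absDiff]
  | coe a =>
    lift b to NNReal using hb
    rw [ENNReal.ofReal_coe_nnreal, ENNReal.coe_toReal]
    rcases le_total a b with h | h
    · rw [abs_of_nonpos (by simpa using h), absDiff, neg_sub, ← NNReal.coe_sub h,
        ENNReal.ofReal_coe_nnreal, ENNReal.coe_sub]
      exact le_add_self
    · rw [abs_of_nonneg (by simpa using h), absDiff, ← NNReal.coe_sub h,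
        ENNReal.ofReal_coe_nnreal, ENNReal.coe_sub]
      exact le_self_add

theorem rpow_le_rpow_add_absDiff_rpow (a b : ℝ≥0∞) {r : ℝ} (hr : 0 ≤ r) (hr' : r ≤ 1) :
    a ^ r ≤ b ^ r + absDiff a b ^ r :=
  (ENNReal.rpow_le_rpow (le_add_absDiff a b) hr).trans (ENNReal.rpow_add_le_add_rpow _ _ hr hr')

theorem absDiff_rpow_le (a b : ℝ≥0∞) {r : ℝ} (hr : 0 ≤ r) (hr' : r ≤ 1) :
    absDiff (a ^ r) (b ^ r) ≤ absDiff a b ^ r :=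
  absDiff_le (rpow_le_rpow_add_absDiff_rpow a b hr hr')
    (absDiff_comm a b ▸ rpow_le_rpow_add_absDiff_rpow b a hr hr')

theorem absDiff_outerLIntegral_le {Ω : Type*} [MeasurableSpace Ω] {κ : Measure Ω}
    {h h' d : Ω → ℝ≥0∞} (hd : ∀ᵐ w ∂κ, h w ≤ h' w + d w) (hd' : ∀ᵐ w ∂κ, h' w ≤ h w + d w) :
    absDiff (outerLIntegral κ h) (outerLIntegral κ h') ≤ outerLIntegral κ d :=
  absDiff_le ((outerLIntegral_mono_ae hd).trans (outerLIntegral_add_le _ _))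
    ((outerLIntegral_mono_ae hd').trans (outerLIntegral_add_le _ _))

end AbsDiff

section SecondMoments

theorem min_sq_eq_sq_min_abs {M : ℝ} (hM : 0 ≤ M) (t : ℝ) : min (t ^ 2) M = min |t| √M ^ 2 := by
  rcases le_total |t| √M with h | h
  · rw [min_eq_left h, sq_abs, min_eq_left]
    exact (sq_abs t) ▸ (Real.le_sqrt (abs_nonneg t) hM).1 h
  · rw [min_eq_right h, Real.sq_sqrt hM, min_eq_right]
    exact (sq_abs t) ▸ (Real.sqrt_le_left (abs_nonneg t)).1 h

theorem abs_min_sq_sub_min_sq_le {M : ℝ} (hM : 0 ≤ M) (a b : ℝ) :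
    |min (a ^ 2) M - min (b ^ 2) M| ≤ 2 * √M * |a - b| := by
  have hsub : |min |a| √M - min |b| √M| ≤ |a - b| :=
    ((abs_min_sub_min_le_max _ _ _ _).trans (by simp)).trans (abs_abs_sub_abs_le a b)
  have hadd : |min |a| √M + min |b| √M| ≤ 2 * √M := by
    rw [abs_of_nonneg (by positivity)]
    linarith [min_le_right |a| √M, min_le_right |b| √M]
  rw [min_sq_eq_sq_min_abs hM, min_sq_eq_sq_min_abs hM, sq_sub_sq, abs_mul]
  gcongr

theorem abs_min_sq_sub_min_sq_le_min {M : ℝ} (hM : 0 ≤ M) (a b : ℝ) :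
    |min (a ^ 2) M - min (b ^ 2) M| ≤ min (2 * √M * |a - b|) M := by
  refine le_min (abs_min_sq_sub_min_sq_le hM a b) (abs_sub_le_of_nonneg_of_le ?_ ?_ ?_ ?_)
  all_goals first | positivity | exact min_le_right _ _

theorem tendsto_integral_min_sq {Ω : Type*} [MeasurableSpace Ω] {ν : Measure Ω} {Z : Ω → ℝ}
    (hZ : MemLp Z 2 ν) :
    Tendsto (fun m : ℕ => ∫ ω, min (Z ω ^ 2) m ∂ν) atTop (𝓝 (∫ ω, Z ω ^ 2 ∂ν)) := by
  refine tendsto_integral_of_dominated_convergence (fun ω => Z ω ^ 2)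
    (fun m => (hZ.1.pow 2).inf aestronglyMeasurable_const) hZ.integrable_sq
    (fun m => .of_forall fun ω => ?_) (.of_forall fun ω => ?_)
  · rw [Real.norm_of_nonneg (by positivity)]
    exact min_le_left _ _
  · refine tendsto_const_nhds.congr' ?_
    filter_upwards [tendsto_natCast_atTop_atTop.eventually_ge_atTop (Z ω ^ 2)] with m hm
    exact (min_eq_left hm).symm

theorem absDiff_outerLIntegral_sq_le_tail {Ω : Type*} [MeasurableSpace Ω] (κ : Measure Ω)
    (T : Ω → ℝ) (M : ℝ) :
    absDiff (outerLIntegral κ fun w => ENNReal.ofReal (T w ^ 2))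
        (outerLIntegral κ fun w => ENNReal.ofReal (min (T w ^ 2) M)) ≤
      outerLIntegral κ ({w | M ≤ T w ^ 2}.indicator fun w => ENNReal.ofReal (T w ^ 2)) := by
  refine absDiff_outerLIntegral_le (.of_forall fun w => ?_)
    (.of_forall fun w => le_add_right (ENNReal.ofReal_le_ofReal (min_le_left _ _)))
  by_cases hw : M ≤ T w ^ 2
  · rw [Set.indicator_of_mem (by exact hw)]
    exact le_add_self
  · rw [min_eq_left (le_of_not_ge hw)]
    exact le_self_add

variable {Ω Ω' : ℕ → Type*} [∀ n, MeasurableSpace (Ω n)] [∀ n, MeasurableSpace (Ω' n)]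
  {μ : ∀ n, Measure (Ω n)} {κ : ∀ n, Measure (Ω' n)} {T Y : ∀ n, Ω n → Ω' n → ℝ}

theorem convOuterProb_absDiff_outerLIntegral_min_sq [∀ n, IsProbabilityMeasure (μ n)]
    [∀ n, IsProbabilityMeasure (κ n)]
    (hTY : CondConvOuterProb μ κ (fun n x w => ENNReal.ofReal |T n x w - Y n x w|)) {M : ℝ}
    (hM : 0 ≤ M) :
    ConvOuterProb μ (fun n x => absDiff
      (outerLIntegral (κ n) fun w => ENNReal.ofReal (min (T n x w ^ 2) M))
      (outerLIntegral (κ n) fun w => ENNReal.ofReal (min (Y n x w ^ 2) M))) := by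
  have hmin : CondConvOuterProb μ κ
      (fun n x w => ENNReal.ofReal (min (2 * √M * |T n x w - Y n x w|) M)) := by
    refine (hTY.const_mul (c := ENNReal.ofReal (2 * √M)) ENNReal.ofReal_ne_top).mono
      (.of_forall fun n => .of_forall fun x => .of_forall fun w => ?_)
    rw [← ENNReal.ofReal_mul (by positivity)]
    exact ENNReal.ofReal_le_ofReal (min_le_left _ _)
  have hle (a b : ℝ) : ENNReal.ofReal (min (a ^ 2) M) ≤
      ENNReal.ofReal (min (b ^ 2) M) + ENNReal.ofReal (min (2 * √M * |a - b|) M) :=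
    (ofReal_le_ofReal_add_ofReal_abs_sub _ _).trans (add_le_add le_rfl
      (ENNReal.ofReal_le_ofReal (abs_min_sq_sub_min_sq_le_min hM a b)))
  refine (hmin.convOuterProb_outerLIntegral ENNReal.ofReal_ne_top fun n x w =>
    ENNReal.ofReal_le_ofReal (min_le_right _ _)).mono (.of_forall fun n => .of_forall fun x => ?_)
  exact absDiff_outerLIntegral_le (.of_forall fun w => hle _ _)
    (.of_forall fun w => abs_sub_comm (Y n x w) (T n x w) ▸ hle _ _)

theorem convOuterProb_absDiff_outerLIntegral_sq [∀ n, IsProbabilityMeasure (μ n)]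
    [∀ n, IsProbabilityMeasure (κ n)]
    (hTY : CondConvOuterProb μ κ (fun n x w => ENNReal.ofReal |T n x w - Y n x w|))
    {u : ℕ → ℝ} {v : ℝ} (huv : Tendsto u atTop (𝓝 v))
    (hY : ∀ m : ℕ, ConvOuterProb μ (fun n x => absDiff
      (outerLIntegral (κ n) fun w => ENNReal.ofReal (min (Y n x w ^ 2) m)) (ENNReal.ofReal (u m))))
    (hT : Tendsto (fun m : ℕ => limsup (fun n => outerLIntegral (μ n) fun x =>
      outerLIntegral (κ n) ({w | (m : ℝ) ≤ T n x w ^ 2}.indicator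
        fun w => ENNReal.ofReal (T n x w ^ 2))) atTop) atTop (𝓝 0)) :
    ConvOuterProb μ (fun n x => absDiff
      (outerLIntegral (κ n) fun w => ENNReal.ofReal (T n x w ^ 2)) (ENNReal.ofReal v)) := by
  let tail (m n : ℕ) (x : Ω n) : ℝ≥0∞ := outerLIntegral (κ n)
    ({w | (m : ℝ) ≤ T n x w ^ 2}.indicator fun w => ENNReal.ofReal (T n x w ^ 2))
  have huv' : Tendsto (fun m => absDiff (ENNReal.ofReal (u m)) (ENNReal.ofReal v)) atTop (𝓝 0) := by
    refine tendsto_of_tendsto_of_tendsto_of_le_of_le tendsto_const_nhds ?_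
      (fun _ => zero_le) fun m => absDiff_ofReal_le (u m) v
    simpa [Function.comp_def, Real.dist_eq] using
      (ENNReal.continuous_ofReal.tendsto 0).comp (tendsto_iff_dist_tendsto_zero.1 huv)
  refine ConvOuterProb.of_le_add (l := atTop)
    (V := fun m n x => tail m n x + absDiff (ENNReal.ofReal (u m)) (ENNReal.ofReal v))
    (.of_forall fun m => (convOuterProb_absDiff_outerLIntegral_min_sq hTY m.cast_nonneg).add (hY m))
    ?_ (.of_forall fun m => .of_forall fun n => .of_forall fun x => ?_)
  · refine tendsto_of_tendsto_of_tendsto_of_le_of_le tendsto_const_nhds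
      (by simpa using hT.add huv') (fun _ => zero_le) fun m => ?_
    calc limsup (fun n => outerLIntegral (μ n) fun x =>
            tail m n x + absDiff (ENNReal.ofReal (u m)) (ENNReal.ofReal v)) atTop
        ≤ limsup (fun n => outerLIntegral (μ n) (tail m n) +
            absDiff (ENNReal.ofReal (u m)) (ENNReal.ofReal v)) atTop :=
          limsup_le_limsup (.of_forall fun n => (outerLIntegral_add_le _ _).trans_eq
            (by rw [outerLIntegral_const]))
      _ = _ := limsup_add_const atTop _ _ (by isBoundedDefault) (by isBoundedDefault)
  · refine ((absDiff_triangle _ _ _).trans (add_le_add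
      (absDiff_outerLIntegral_sq_le_tail (κ n) (T n x) m)
      ((absDiff_triangle _ _ _).trans
        (add_le_add_right (absDiff_triangle _ (ENNReal.ofReal (u m)) _)
          (absDiff _ (outerLIntegral (κ n) fun w => ENNReal.ofReal (min (Y n x w ^ 2) m))))))
      ).trans_eq ?_
    ring

end SecondMoments

section Support

theorem measure_compl_support_of_isTightMeasureSet {D : Type*} [PseudoMetricSpace D]
    [MeasurableSpace D] {ν : Measure D} (hν : IsTightMeasureSet {ν}) :
    ν ν.supportᶜ = 0 := by
  obtain ⟨C, hC, hC_sub, hC_Union, -⟩ :=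
    Measure.isOpen_compl_support (μ := ν) |>.exists_iUnion_isClosed
  refine le_antisymm (le_of_forall_pos_le_add fun ε hε => ?_) zero_le
  obtain ⟨K, hK, hKε⟩ := isTightMeasureSet_iff_exists_isCompact_measure_compl_le.1 hν ε hε
  have hCK : ν (⋃ k, C k ∩ K) = 0 := measure_iUnion_null fun k =>
    Measure.measure_eq_zero_of_isCompact_subset_compl_support (hK.inter_left (hC k))
      (Set.inter_subset_left.trans (hC_sub k))
  calc ν ν.supportᶜ ≤ ν ((⋃ k, C k ∩ K) ∪ Kᶜ) := measure_mono fun z hz => by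
        obtain ⟨k, hk⟩ := Set.mem_iUnion.1 (hC_Union ▸ hz)
        by_cases hzK : z ∈ K
        · exact .inl (Set.mem_iUnion.2 ⟨k, hk, hzK⟩)
        · exact .inr hzK
    _ ≤ ν (⋃ k, C k ∩ K) + ν Kᶜ := measure_union_le _ _
    _ ≤ 0 + ε := add_le_add hCK.le (hKε ν rfl)

end Support

section Bridge

variable {𝒳 : Type*} {F : Set (𝒳 → ℝ)}

theorem EllInf.dist_apply_le (z z' : EllInf F) (f : F) : dist (z f) (z' f) ≤ dist z z' := by
  rw [dist_eq_norm, dist_eq_norm]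
  exact lp.norm_apply_le_norm ENNReal.top_ne_zero (z - z') f

theorem EllInf.lipschitzWith_apply (f : F) : LipschitzWith 1 fun z : EllInf F => z f :=
  .of_dist_le_mul fun z z' => by simpa using dist_apply_le z z' f

theorem EllInf.measurable_apply (f : F) : Measurable fun z : EllInf F => z f :=
  (lipschitzWith_apply f).continuous.measurable

theorem EllInf.abs_sub_apply_le (z z' : EllInf F) (f g : F) :
    |z f - z g| ≤ |z' f - z' g| + 2 * dist z z' := by
  have hf := abs_le.1 (dist_apply_le z z' f)
  have hg := abs_le.1 (dist_apply_le z z' g)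
  rw [abs_le]
  constructor <;> cases abs_cases (z' f - z' g) <;> linarith

theorem toEllInf_apply {z : F → ℝ} (hz : Memℓp (E := fun _ : F => ℝ) z ∞) (f : F) :
    toEllInf F z f = z f := by
  rw [toEllInf, dif_pos hz]

variable [MeasurableSpace 𝒳] {P : Measure 𝒳}

/-- The oscillation of `z` over the `L₂(P)`-ball of radius `δ` around `f₀`, truncated at `1` so
that it is a bounded function of `z`. -/
noncomputable def localOsc (P : Measure 𝒳) (f₀ : F) (δ : ℝ) (z : EllInf F) : ℝ :=
  ⨆ f : {f : F // eLpNorm (f.1 - f₀.1) 2 P < ENNReal.ofReal δ}, min 1 |z f.1 - z f₀|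

theorem localOsc_nonneg (f₀ : F) (δ : ℝ) (z : EllInf F) : 0 ≤ localOsc P f₀ δ z :=
  Real.iSup_nonneg fun _ => by positivity

theorem localOsc_le {f₀ : F} {δ : ℝ} {z : EllInf F} {c : ℝ} (hc : 0 ≤ c)
    (h : ∀ f : F, eLpNorm (f.1 - f₀.1) 2 P < ENNReal.ofReal δ → min 1 |z f - z f₀| ≤ c) :
    localOsc P f₀ δ z ≤ c :=
  Real.iSup_le (fun f => h f.1 f.2) hc

theorem localOsc_le_one (f₀ : F) (δ : ℝ) (z : EllInf F) : localOsc P f₀ δ z ≤ 1 :=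
  localOsc_le zero_le_one fun _ _ => min_le_left _ _

theorem le_localOsc {f₀ f : F} {δ : ℝ} (z : EllInf F)
    (hf : eLpNorm (f.1 - f₀.1) 2 P < ENNReal.ofReal δ) :
    min 1 |z f - z f₀| ≤ localOsc P f₀ δ z :=
  le_ciSup (f := fun f : {f : F // eLpNorm (f.1 - f₀.1) 2 P < ENNReal.ofReal δ} =>
    min 1 |z f.1 - z f₀|) ⟨1, by rintro _ ⟨f, rfl⟩; exact min_le_left _ _⟩ ⟨f, hf⟩

theorem lipschitzWith_localOsc (f₀ : F) (δ : ℝ) : LipschitzWith 2 (localOsc P f₀ δ) := by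
  refine LipschitzWith.of_le_add_mul 2 fun z z' => ?_
  rw [NNReal.coe_ofNat]
  refine localOsc_le (add_nonneg (localOsc_nonneg _ _ _) (by positivity)) fun f hf => ?_
  calc min 1 |z f - z f₀| ≤ min 1 (|z' f - z' f₀| + 2 * dist z z') :=
        min_le_min_left _ (EllInf.abs_sub_apply_le z z' f f₀)
    _ ≤ min 1 |z' f - z' f₀| + 2 * dist z z' := by
        rw [← min_add_add_right]
        exact min_le_min_right _ (le_add_of_nonneg_right (by positivity))
    _ ≤ localOsc P f₀ δ z' + 2 * dist z z' := by gcongr; exact le_localOsc z' hf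

namespace IsBrownianBridge

variable {ν : Measure (EllInf F)}

theorem memLp_apply (h : IsBrownianBridge P F ν) (f : F) : MemLp (fun z : EllInf F => z f) 2 ν :=
  (h.gaussian.hasGaussianLaw_eval f).memLp_two

variable [IsProbabilityMeasure P]

theorem covariance_apply (h : IsBrownianBridge P F ν) (f g : F) :
    cov[fun z : EllInf F => z f, fun z => z g; ν] = cov[f.1, g.1; P] := by
  have := h.isProbabilityMeasure
  rw [covariance_eq_sub (h.memLp_apply f) (h.memLp_apply g),
    covariance_eq_sub (h.memLp f.1 f.2) (h.memLp g.1 g.2), h.mean, zero_mul, sub_zero]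
  exact h.cov f g

theorem variance_apply (h : IsBrownianBridge P F ν) (f : F) :
    Var[fun z : EllInf F => z f; ν] = Var[f.1; P] := by
  rw [← covariance_self (h.memLp_apply f).aemeasurable,
    ← covariance_self (h.memLp f.1 f.2).aemeasurable, h.covariance_apply]

theorem variance_apply_sub (h : IsBrownianBridge P F ν) (f g : F) :
    Var[fun z : EllInf F => z f - z g; ν] = Var[f.1 - g.1; P] := by
  have := h.isProbabilityMeasure
  rw [variance_fun_sub (h.memLp_apply f) (h.memLp_apply g),
    variance_sub (h.memLp f.1 f.2) (h.memLp g.1 g.2), h.variance_apply, h.variance_apply,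
    h.covariance_apply]

theorem map_apply (h : IsBrownianBridge P F ν) (f : F) :
    ν.map (fun z : EllInf F => z f) = gaussianReal 0 Var[f.1; P].toNNReal := by
  rw [(h.gaussian.hasGaussianLaw_eval f).map_eq_gaussianReal, h.mean f, h.variance_apply]

theorem measure_abs_sub_ge_le (h : IsBrownianBridge P F ν) (f g : F) {ε : ℝ} (hε : 0 < ε) :
    ν {z | ε ≤ |z f - z g|} ≤ eLpNorm (f.1 - g.1) 2 P ^ 2 / ENNReal.ofReal (ε ^ 2) := by
  have := h.isProbabilityMeasure
  have hmean : ∫ z : EllInf F, (z f - z g) ∂ν = 0 := by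
    rw [integral_sub ((h.memLp_apply f).integrable one_le_two)
      ((h.memLp_apply g).integrable one_le_two), h.mean, h.mean, sub_zero]
  have hfg : MemLp (f.1 - g.1) 2 P := (h.memLp f.1 f.2).sub (h.memLp g.1 g.2)
  have hcheb := meas_ge_le_variance_div_sq ((h.memLp_apply f).sub (h.memLp_apply g)) hε
  simp only [Pi.sub_apply, hmean, sub_zero] at hcheb
  refine hcheb.trans ?_
  rw [ENNReal.ofReal_div_of_pos (by positivity)]
  gcongr
  calc ENNReal.ofReal Var[fun z : EllInf F => z f - z g; ν]
      = evariance (f.1 - g.1) P := by rw [h.variance_apply_sub, hfg.ofReal_variance_eq]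
    _ ≤ ∫⁻ x, ‖(f.1 - g.1) x‖ₑ ^ 2 ∂P := by
        rw [evariance_def' hfg.aestronglyMeasurable]
        exact tsub_le_self
    _ = eLpNorm (f.1 - g.1) 2 P ^ 2 := by
        simpa using (eLpNorm_nnreal_pow_eq_lintegral (f := f.1 - g.1) (μ := P)
          (p := 2) two_ne_zero).symm

-- A ball of positive mass around `z` contains a path with a small increment from `f₀` to `f`, as
-- soon as Chebyshev's bound for that increment is smaller than the mass of the ball.
theorem tendsto_localOsc (h : IsBrownianBridge P F ν) (f₀ : F) {z : EllInf F}
    (hz : z ∈ ν.support) : Tendsto (fun δ => localOsc P f₀ δ z) (𝓝[>] 0) (𝓝 0) := by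
  refine Metric.tendsto_nhds.2 fun η hη => ?_
  have hε : 0 < η / 4 := by positivity
  have hmass : 0 < ν (Metric.ball z (η / 4)) :=
    (Measure.mem_support_iff_forall z).1 hz _ (Metric.ball_mem_nhds z hε)
  have hcheb : Tendsto (fun δ => ENNReal.ofReal δ ^ 2 / ENNReal.ofReal ((η / 4) ^ 2))
      (𝓝[>] 0) (𝓝 0) := by
    simpa using ENNReal.Tendsto.div_const (ENNReal.Tendsto.pow (n := 2) tendsto_ofReal_nhdsGT_zero)
      (.inr (ENNReal.ofReal_pos.2 (pow_pos hε 2)).ne')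
  filter_upwards [hcheb.eventually (gt_mem_nhds hmass)] with δ hδ
  rw [Real.dist_0_eq_abs, abs_of_nonneg (localOsc_nonneg _ _ _)]
  refine lt_of_le_of_lt (localOsc_le (c := 3 * (η / 4)) (by positivity) fun f hf => ?_)
    (by linarith)
  have hnot_sub : ¬ Metric.ball z (η / 4) ⊆ {z' | η / 4 ≤ |z' f - z' f₀|} := fun hsub => by
    refine absurd hδ (not_lt.2 ((measure_mono hsub).trans ?_))
    exact (h.measure_abs_sub_ge_le f f₀ hε).trans (by gcongr)
  obtain ⟨z', hz', hz'_lt⟩ := Set.not_subset.1 hnot_sub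
  have hdist := Metric.mem_ball'.1 hz'
  linarith [min_le_right 1 |z f - z f₀|, EllInf.abs_sub_apply_le z z' f f₀,
    not_le.1 (show ¬ η / 4 ≤ |z' f - z' f₀| from hz'_lt)]

theorem tendsto_integral_localOsc (h : IsBrownianBridge P F ν) (f₀ : F) :
    Tendsto (fun δ => ∫ z, localOsc P f₀ δ z ∂ν) (𝓝[>] 0) (𝓝 0) := by
  have := h.isProbabilityMeasure
  have hsupp : ∀ᵐ z ∂ν, z ∈ ν.support := measure_compl_support_of_isTightMeasureSet h.tight
  suffices hlim : Tendsto (fun δ => ∫ z, localOsc P f₀ δ z ∂ν) (𝓝[>] 0) (𝓝 (∫ _, (0 : ℝ) ∂ν)) by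
    rwa [integral_zero] at hlim
  refine tendsto_integral_filter_of_dominated_convergence (fun _ => 1)
    (.of_forall fun δ => (lipschitzWith_localOsc f₀ δ).continuous.aestronglyMeasurable)
    (.of_forall fun δ => .of_forall fun z => ?_) (integrable_const _)
    (hsupp.mono fun z hz => h.tendsto_localOsc f₀ hz)
  rw [Real.norm_of_nonneg (localOsc_nonneg _ _ _)]
  exact localOsc_le_one _ _ _

end IsBrownianBridge

end Bridge

section WeakConvergence

variable {Ω Ω' : ℕ → Type*} [∀ n, MeasurableSpace (Ω n)] [∀ n, MeasurableSpace (Ω' n)]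
  {μ : ∀ n, Measure (Ω n)} {κ : ∀ n, Measure (Ω' n)}
  {D : Type*} [PseudoMetricSpace D] [MeasurableSpace D] {ν : Measure D}

theorem CondOuterWeakConv.convOuterProb_outerLIntegral_of_mem_BL1
    [∀ n, IsProbabilityMeasure (κ n)] {G : ∀ n, Ω n → Ω' n → D} (hG : CondOuterWeakConv μ κ G ν)
    {h : D → ℝ} (hh : h ∈ BL1 D) (h0 : ∀ z, 0 ≤ h z) :
    ConvOuterProb μ (fun n x => absDiff
      (outerLIntegral (κ n) fun w => ENNReal.ofReal (h (G n x w)))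
      (ENNReal.ofReal (∫ z, h z ∂ν))) := by
  refine ConvOuterProb.mono hG (.of_forall fun n => .of_forall fun x => ?_)
  rw [← ofReal_outerExp (fun w => h0 _) fun w => (abs_le.1 (hh.2 _)).2]
  exact (absDiff_ofReal_le _ _).trans
    (le_iSup₂ (f := fun h (_ : h ∈ BL1 D) => ENNReal.ofReal
      |outerExp (κ n) (fun w => h (G n x w)) - ∫ z, h z ∂ν|) h hh)

theorem CondOuterWeakConv.convOuterProb_outerLIntegral [∀ n, IsProbabilityMeasure (κ n)]
    {G : ∀ n, Ω n → Ω' n → D} (hG : CondOuterWeakConv μ κ G ν) {h : D → ℝ} {K : NNReal}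
    (hK : LipschitzWith K h) {M : ℝ} (h0 : ∀ z, 0 ≤ h z) (hM : ∀ z, h z ≤ M) :
    ConvOuterProb μ (fun n x => absDiff
      (outerLIntegral (κ n) fun w => ENNReal.ofReal (h (G n x w)))
      (ENNReal.ofReal (∫ z, h z ∂ν))) := by
  let c : ℝ := max 1 (max K M)
  have hc : 0 < c := lt_max_of_lt_left one_pos
  have hc0 : ENNReal.ofReal c ≠ 0 := (ENNReal.ofReal_pos.2 hc).ne'
  have hBL : (fun z => c⁻¹ * h z) ∈ BL1 D := by
    refine ⟨.of_le_add fun z z' => ?_, fun z => ?_⟩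
    · calc c⁻¹ * h z ≤ c⁻¹ * (h z' + c * dist z z') := by
            gcongr
            refine (hK.le_add_mul z z').trans ?_
            gcongr
            exact (le_max_left _ _).trans (le_max_right _ _)
        _ = c⁻¹ * h z' + dist z z' := by rw [mul_add, inv_mul_cancel_left₀ hc.ne']
    · rw [abs_of_nonneg (by have := h0 z; positivity), inv_mul_le_iff₀ hc, mul_one]
      exact (hM z).trans ((le_max_right _ _).trans (le_max_right _ _))
  have hscale (t : ℝ) : ENNReal.ofReal t = ENNReal.ofReal c * ENNReal.ofReal (c⁻¹ * t) := by
    rw [← ENNReal.ofReal_mul hc.le, mul_inv_cancel_left₀ hc.ne']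
  refine ((hG.convOuterProb_outerLIntegral_of_mem_BL1 hBL fun z =>
    mul_nonneg (inv_nonneg.2 hc.le) (h0 z)).const_mul (c := ENNReal.ofReal c)
      ENNReal.ofReal_ne_top).mono (.of_forall fun n => .of_forall fun x => ?_)
  simp only [integral_const_mul, hscale (h _), hscale (∫ z, h z ∂ν),
    outerLIntegral_const_mul _ hc0 ENNReal.ofReal_ne_top]
  exact absDiff_mul_le _ _ _

theorem OuterWeakConv.tendsto_absDiff_outerLIntegral [∀ n, IsProbabilityMeasure (μ n)]
    {G : ∀ n, Ω n → D} (hG : OuterWeakConv μ G ν) {h : D → ℝ} (hc : Continuous h) {M : ℝ}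
    (h0 : ∀ z, 0 ≤ h z) (hM : ∀ z, h z ≤ M) :
    Tendsto (fun n => absDiff (outerLIntegral (μ n) fun x => ENNReal.ofReal (h (G n x)))
      (ENNReal.ofReal (∫ z, h z ∂ν))) atTop (𝓝 0) := by
  have hlim := hG (.ofNormedAddCommGroup h hc M fun z => by
    rw [Real.norm_of_nonneg (h0 z)]; exact hM z)
  refine tendsto_of_tendsto_of_tendsto_of_le_of_le tendsto_const_nhds
    (h := fun n => ENNReal.ofReal |outerExp (μ n) (fun x => h (G n x)) - ∫ z, h z ∂ν|)
    ?_ (fun _ => zero_le) fun n => ?_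
  · simpa [Function.comp_def, Real.dist_eq] using
      (ENNReal.continuous_ofReal.tendsto 0).comp (tendsto_iff_dist_tendsto_zero.1 hlim)
  · change absDiff _ _ ≤ _
    rw [← ofReal_outerExp (fun x => h0 _) fun x => hM _]
    exact absDiff_ofReal_le _ _

theorem OuterWeakConv.tendstoInDistribution [OpensMeasurableSpace D] [IsProbabilityMeasure ν]
    [∀ n, IsProbabilityMeasure (μ n)] {G : ∀ n, Ω n → D} (hG : OuterWeakConv μ G ν)
    {E : Type*} [TopologicalSpace E] [MeasurableSpace E] [BorelSpace E]
    {A : ∀ n, Ω n → E} (hA : ∀ n, Measurable (A n)) {π : D → E} (hπ : Continuous π)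
    (hAG : ∀ᶠ n in atTop, ∀ᵐ x ∂(μ n), A n x = π (G n x)) :
    TendstoInDistribution A atTop π μ ν := by
  refine ⟨fun n => (hA n).aemeasurable, hπ.measurable.aemeasurable, ?_⟩
  refine ProbabilityMeasure.tendsto_iff_forall_integral_tendsto.2 fun g => ?_
  have hlim := hG (g.compContinuous ⟨π, hπ⟩)
  simp only [ProbabilityMeasure.coe_mk, BoundedContinuousFunction.compContinuous_apply,
    ContinuousMap.coe_mk] at hlim ⊢
  rw [integral_map hπ.measurable.aemeasurable g.continuous.aestronglyMeasurable]
  refine hlim.congr' (hAG.mono fun n hn => ?_)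
  dsimp only
  rw [integral_map (hA n).aemeasurable g.continuous.aestronglyMeasurable,
    ← outerExp_eq_integral]
  · exact outerExp_congr_ae (hn.mono fun x hx => congrArg g hx.symm)
  · exact .of_bound (g.continuous.measurable.comp (hA n)).aestronglyMeasurable ‖g‖
      (.of_forall fun _ => g.norm_coe_le_norm _)

end WeakConvergence

section Equicontinuity

variable {𝒳 : Type*} [MeasurableSpace 𝒳] {P : Measure 𝒳} {F : Set (𝒳 → ℝ)}

theorem measure_abs_sub_ge_le_localOsc {Ω : Type*} [MeasurableSpace Ω] {κ : Measure Ω}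
    {G : Ω → (𝒳 → ℝ) → ℝ} (hG : ∀ᵐ w ∂κ, Memℓp (E := fun _ : F => ℝ) (fun f : F => G w f) ∞)
    (g : Ω → 𝒳 → ℝ) (f₀ : F) {ε : ℝ} (hε : 0 < ε) (δ : ℝ) :
    κ {w | ENNReal.ofReal ε ≤ ENNReal.ofReal |G w (g w) - G w f₀|} ≤
      κ {w | g w ∉ F} + κ {w | ENNReal.ofReal δ ≤ eLpNorm (g w - f₀.1) 2 P} +
      (ENNReal.ofReal (min 1 ε))⁻¹ *
        outerLIntegral κ fun w => ENNReal.ofReal (localOsc P f₀ δ (toEllInf F fun f => G w f)) := by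
  have hmin : ENNReal.ofReal (min 1 ε) ≠ 0 := (ENNReal.ofReal_pos.2 (lt_min one_pos hε)).ne'
  calc κ {w | ENNReal.ofReal ε ≤ ENNReal.ofReal |G w (g w) - G w f₀|}
      ≤ κ ({w | g w ∉ F} ∪ {w | ENNReal.ofReal δ ≤ eLpNorm (g w - f₀.1) 2 P} ∪
          {w | ENNReal.ofReal (min 1 ε) ≤
            ENNReal.ofReal (localOsc P f₀ δ (toEllInf F fun f => G w f))}) := by
        refine measure_mono_ae (hG.mono fun w hw hge => ?_)
        by_cases hgF : g w ∈ F
        · rcases le_or_gt (ENNReal.ofReal δ) (eLpNorm (g w - f₀.1) 2 P) with hfar | hnear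
          · exact .inl (.inr hfar)
          · refine .inr (ENNReal.ofReal_le_ofReal ?_)
            refine le_trans ?_ (le_localOsc (f := ⟨g w, hgF⟩) _ hnear)
            rw [toEllInf_apply hw, toEllInf_apply hw]
            exact min_le_min_left 1 ((ENNReal.ofReal_le_ofReal_iff (abs_nonneg _)).1 hge)
        · exact .inl (.inl hgF)
    _ ≤ _ := (measure_union_le _ _).trans (add_le_add (measure_union_le _ _)
        (measure_ge_le_inv_mul_outerLIntegral _ hmin ENNReal.ofReal_ne_top))

variable {Ω Ω' : ℕ → Type*} [∀ n, MeasurableSpace (Ω n)] [∀ n, MeasurableSpace (Ω' n)]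
  {μ : ∀ n, Measure (Ω n)} {κ : ∀ n, Measure (Ω' n)} [IsProbabilityMeasure P]
  {ν : Measure (EllInf F)}

theorem IsBrownianBridge.condConvOuterProb_abs_sub_of_localOsc [∀ n, IsProbabilityMeasure (μ n)]
    (hν : IsBrownianBridge P F ν) (f₀ : F) {G : ∀ n, Ω n → Ω' n → (𝒳 → ℝ) → ℝ}
    {g : ∀ n, Ω n → Ω' n → 𝒳 → ℝ}
    (hG : ∀ᶠ n in atTop, ∀ᵐ x ∂(μ n), ∀ᵐ w ∂(κ n),
      Memℓp (E := fun _ : F => ℝ) (fun f : F => G n x w f) ∞)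
    (hosc : ∀ δ, ConvOuterProb μ (fun n x => absDiff
      (outerLIntegral (κ n) fun w =>
        ENNReal.ofReal (localOsc P f₀ δ (toEllInf F fun f => G n x w f)))
      (ENNReal.ofReal (∫ z, localOsc P f₀ δ z ∂ν))))
    (hgF : ConvOuterProb μ (fun n x => κ n {w | g n x w ∉ F}))
    (hg : CondConvOuterProb μ κ (fun n x w => eLpNorm (g n x w - f₀.1) 2 P)) :
    CondConvOuterProb μ κ
      (fun n x w => ENNReal.ofReal |G n x w (g n x w) - G n x w f₀|) := by
  intro ε hε
  have hc : (ENNReal.ofReal (min 1 ε))⁻¹ ≠ ∞ :=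
    ENNReal.inv_ne_top.2 (ENNReal.ofReal_pos.2 (lt_min one_pos hε)).ne'
  have hbridge : Tendsto (fun δ => (ENNReal.ofReal (min 1 ε))⁻¹ *
      ENNReal.ofReal (∫ z, localOsc P f₀ δ z ∂ν)) (𝓝[>] 0) (𝓝 0) := by
    have := (ENNReal.continuous_ofReal.tendsto 0).comp (hν.tendsto_integral_localOsc f₀)
    simpa using ENNReal.Tendsto.const_mul this (.inr hc)
  refine ConvOuterProb.of_le_add (l := 𝓝[>] (0 : ℝ))
    (U := fun δ n x => κ n {w | g n x w ∉ F} +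
      κ n {w | ENNReal.ofReal δ ≤ eLpNorm (g n x w - f₀.1) 2 P} + (ENNReal.ofReal (min 1 ε))⁻¹ *
        absDiff (outerLIntegral (κ n) fun w =>
          ENNReal.ofReal (localOsc P f₀ δ (toEllInf F fun f => G n x w f)))
        (ENNReal.ofReal (∫ z, localOsc P f₀ δ z ∂ν)))
    (V := fun δ _ _ => (ENNReal.ofReal (min 1 ε))⁻¹ *
      ENNReal.ofReal (∫ z, localOsc P f₀ δ z ∂ν)) ?_
    (by simpa only [outerLIntegral_const, limsup_const] using hbridge)
    (.of_forall fun δ => hG.mono fun n hn => hn.mono fun x hx => ?_)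
  · filter_upwards [self_mem_nhdsWithin] with δ hδ
    exact (hgF.add (hg δ hδ)).add ((hosc δ).const_mul hc)
  · refine (measure_abs_sub_ge_le_localOsc (P := P) hx _ f₀ hε δ).trans ?_
    rw [add_assoc, add_assoc, ← mul_add, add_comm (absDiff _ _), ← add_assoc]
    gcongr
    exact le_add_absDiff _ _

theorem IsBrownianBridge.condConvOuterProb_abs_sub [∀ n, IsProbabilityMeasure (μ n)]
    [∀ n, IsProbabilityMeasure (κ n)]
    (hν : IsBrownianBridge P F ν) (f₀ : F) {G : ∀ n, Ω n → Ω' n → (𝒳 → ℝ) → ℝ}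
    {g : ∀ n, Ω n → Ω' n → 𝒳 → ℝ}
    (hG : ∀ᶠ n in atTop, ∀ᵐ x ∂(μ n), ∀ᵐ w ∂(κ n),
      Memℓp (E := fun _ : F => ℝ) (fun f : F => G n x w f) ∞)
    (hGν : CondOuterWeakConv μ κ (fun n x w => toEllInf F fun f => G n x w f) ν)
    (hgF : ConvOuterProb μ (fun n x => κ n {w | g n x w ∉ F}))
    (hg : CondConvOuterProb μ κ (fun n x w => eLpNorm (g n x w - f₀.1) 2 P)) :
    CondConvOuterProb μ κ
      (fun n x w => ENNReal.ofReal |G n x w (g n x w) - G n x w f₀|) :=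
  hν.condConvOuterProb_abs_sub_of_localOsc f₀ hG
    (fun δ => hGν.convOuterProb_outerLIntegral (lipschitzWith_localOsc f₀ δ)
      (localOsc_nonneg f₀ δ) (localOsc_le_one f₀ δ)) hgF hg

theorem condConvOuterProb_dirac_unit {Y : ∀ n, Ω n → ℝ≥0∞} :
    CondConvOuterProb (fun _ => Measure.dirac ()) μ (fun n (_ : Unit) => Y n) ↔
      ConvOuterProb μ Y :=
  forall₂_congr fun _ _ => convOuterProb_dirac_unit

-- Unconditional convergence is convergence conditionally on trivial data.
theorem IsBrownianBridge.convOuterProb_abs_sub [∀ n, IsProbabilityMeasure (μ n)]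
    (hν : IsBrownianBridge P F ν) (f₀ : F) {G : ∀ n, Ω n → (𝒳 → ℝ) → ℝ}
    {g : ∀ n, Ω n → 𝒳 → ℝ}
    (hG : ∀ᶠ n in atTop, ∀ᵐ x ∂(μ n), Memℓp (E := fun _ : F => ℝ) (fun f : F => G n x f) ∞)
    (hGν : OuterWeakConv μ (fun n x => toEllInf F fun f => G n x f) ν)
    (hgF : Tendsto (fun n => μ n {x | g n x ∉ F}) atTop (𝓝 0))
    (hg : ConvOuterProb μ (fun n x => eLpNorm (g n x - f₀.1) 2 P)) :
    ConvOuterProb μ (fun n x => ENNReal.ofReal |G n x (g n x) - G n x f₀|) :=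
  condConvOuterProb_dirac_unit.1 <| hν.condConvOuterProb_abs_sub_of_localOsc f₀
    (G := fun n _ => G n) (g := fun n _ => g n)
    (hG.mono fun _ hn => .of_forall fun _ => hn)
    (fun δ => convOuterProb_dirac_unit.2 (hGν.tendsto_absDiff_outerLIntegral
      (lipschitzWith_localOsc f₀ δ).continuous (localOsc_nonneg f₀ δ) (localOsc_le_one f₀ δ)))
    (convOuterProb_dirac_unit.2 hgF) (condConvOuterProb_dirac_unit.2 hg)

end Equicontinuity

section Slutsky

theorem mem_Icc_iff_of_abs_sub_lt {S A L U a b : ℝ}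
    (ha : |S - A| + |L - a| + |U - b| < |A - a|) (hb : |S - A| + |L - a| + |U - b| < |A - b|) :
    S ∈ Set.Icc L U ↔ A ∈ Set.Icc a b := by
  obtain ⟨hSA, hAS⟩ := abs_le.1 (le_refl |S - A|)
  obtain ⟨hLa, haL⟩ := abs_le.1 (le_refl |L - a|)
  obtain ⟨hUb, hbU⟩ := abs_le.1 (le_refl |U - b|)
  refine and_congr ⟨fun hLS => ?_, fun haA => ?_⟩ ⟨fun hSU => ?_, fun hAb => ?_⟩
  · cases abs_cases (A - a) <;> linarith
  · rw [abs_of_nonneg (sub_nonneg.2 haA)] at ha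
    linarith
  · cases abs_cases (A - b) <;> linarith
  · rw [abs_of_nonpos (sub_nonpos.2 hAb)] at hb
    linarith

theorem measure_frontier_Icc {μ : Measure ℝ} [NullSingletonClass μ] (a b : ℝ) :
    μ (frontier (Set.Icc a b)) = 0 := by
  rcases le_or_gt a b with hab | hab
  · rw [frontier_Icc hab]
    exact (Set.toFinite _).measure_zero μ
  · simp [Set.Icc_eq_empty hab.not_ge]

theorem tendsto_measure_of_tendsto_measure_symmDiff {Ω : ℕ → Type*} [∀ n, MeasurableSpace (Ω n)]
    {μ : ∀ n, Measure (Ω n)} {s t : ∀ n, Set (Ω n)} {p : ℝ≥0∞}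
    (hst : Tendsto (fun n => μ n (symmDiff (s n) (t n))) atTop (𝓝 0))
    (ht : Tendsto (fun n => μ n (t n)) atTop (𝓝 p)) :
    Tendsto (fun n => μ n (s n)) atTop (𝓝 p) := by
  refine tendsto_of_tendsto_of_tendsto_of_le_of_le
    (by simpa using ENNReal.Tendsto.sub ht hst (.inr ENNReal.zero_ne_top))
    (by simpa using ht.add hst) (fun n => tsub_le_iff_right.2 ?_) fun n => ?_
  · refine (measure_mono fun x hx => ?_).trans (measure_union_le _ _)
    exact (em (x ∈ s n)).imp_right fun hs => .inr ⟨hx, hs⟩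
  · refine (measure_mono fun x hx => ?_).trans (measure_union_le _ _)
    exact (em (x ∈ t n)).imp_right fun ht => .inl ⟨hx, ht⟩

variable {Ω : ℕ → Type*} [∀ n, MeasurableSpace (Ω n)] {μ : ∀ n, Measure (Ω n)}
  [∀ n, IsProbabilityMeasure (μ n)] {Ω' : Type*} [MeasurableSpace Ω'] {ν : Measure Ω'}
  [IsProbabilityMeasure ν] {A : ∀ n, Ω n → ℝ} {Z : Ω' → ℝ}

theorem tendsto_measure_mem_Icc [NullSingletonClass (ν.map Z)]
    (hA : TendstoInDistribution A atTop Z μ ν) (a b : ℝ) :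
    Tendsto (fun n => μ n {x | A n x ∈ Set.Icc a b}) atTop (𝓝 (ν.map Z (Set.Icc a b))) :=
  (ProbabilityMeasure.tendsto_measure_of_null_frontier_of_tendsto' hA.tendsto
    (measure_frontier_Icc (μ := ν.map Z) a b)).congr fun n =>
      Measure.map_apply_of_aemeasurable (hA.forall_aemeasurable n) measurableSet_Icc

theorem tendsto_measure_symmDiff_mem_Icc [NullSingletonClass (ν.map Z)]
    (hA : TendstoInDistribution A atTop Z μ ν) {S L U : ∀ n, Ω n → ℝ} {a b : ℝ}
    (hD : ConvOuterProb μ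
      (fun n x => ENNReal.ofReal (|S n x - A n x| + |L n x - a| + |U n x - b|))) :
    Tendsto (fun n => μ n (symmDiff {x | S n x ∈ Set.Icc (L n x) (U n x)}
      {x | A n x ∈ Set.Icc a b})) atTop (𝓝 0) := by
  have : IsProbabilityMeasure (ν.map Z) := Measure.isProbabilityMeasure_map hA.aemeasurable_limit
  have hv (τ : ℝ) : Tendsto (fun n => μ n {x | A n x ∈ Set.Icc (a - τ) (a + τ)} +
      μ n {x | A n x ∈ Set.Icc (b - τ) (b + τ)}) atTop
      (𝓝 (ν.map Z (Set.Icc (a - τ) (a + τ)) + ν.map Z (Set.Icc (b - τ) (b + τ)))) :=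
    (tendsto_measure_mem_Icc hA _ _).add (tendsto_measure_mem_Icc hA _ _)
  refine tendsto_zero_of_le_add_of_limsup (l := 𝓝[>] (0 : ℝ))
    (u := fun τ n => μ n {x | ENNReal.ofReal τ ≤
      ENNReal.ofReal (|S n x - A n x| + |L n x - a| + |U n x - b|)})
    (v := fun τ n => μ n {x | A n x ∈ Set.Icc (a - τ) (a + τ)} +
      μ n {x | A n x ∈ Set.Icc (b - τ) (b + τ)})
    (eventually_mem_nhdsWithin.mono fun τ hτ => hD τ hτ) ?_ (.of_forall fun τ => .of_forall
      fun n => ?_)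
  · simp only [fun τ => (hv τ).limsup_eq]
    simpa using ((tendsto_measure_Icc (ν.map Z) a).add
      (tendsto_measure_Icc (ν.map Z) b)).mono_left nhdsWithin_le_nhds
  · refine (measure_mono fun x hx => ?_).trans
      ((measure_union_le _ _).trans (add_le_add le_rfl (measure_union_le _ _)))
    by_contra hgood
    obtain ⟨hDτ, haτ, hbτ⟩ : _ ∧ _ ∧ _ := by simpa only [Set.mem_union, not_or] using hgood
    have hD : |S n x - A n x| + |L n x - a| + |U n x - b| < τ :=
      lt_of_not_ge fun h => hDτ (ENNReal.ofReal_le_ofReal h)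
    have ha : τ < |A n x - a| := abs_sub_comm a (A n x) ▸
      lt_of_not_ge fun h => haτ (Set.mem_Icc_iff_abs_le.1 h)
    have hb : τ < |A n x - b| := abs_sub_comm b (A n x) ▸
      lt_of_not_ge fun h => hbτ (Set.mem_Icc_iff_abs_le.1 h)
    have hiff := mem_Icc_iff_of_abs_sub_lt (hD.trans ha) (hD.trans hb)
    exact hx.elim (fun h => h.2 (hiff.1 h.1)) fun h => h.2 (hiff.2 h.1)

end Slutsky

section NormalQuantile

theorem continuous_cdf_of_nullSingletonClass (μ : Measure ℝ) [IsProbabilityMeasure μ]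
    [NullSingletonClass μ] : Continuous (cdf μ) := by
  refine continuous_iff_continuousAt.2 fun a => ?_
  have hjump : (cdf μ).measure {a} = 0 := by rw [measure_cdf, measure_singleton]
  rw [StieltjesFunction.measure_singleton, ENNReal.ofReal_eq_zero, sub_nonpos] at hjump
  rw [(monotone_cdf μ).continuousAt_iff_leftLim_eq_rightLim, StieltjesFunction.rightLim_eq]
  exact le_antisymm ((monotone_cdf μ).leftLim_le le_rfl) hjump

theorem cdf_sInf_setOf_le_cdf {μ : Measure ℝ} [IsProbabilityMeasure μ] [NullSingletonClass μ]
    {p : ℝ} (hp₀ : 0 < p) (hp₁ : p < 1) : cdf μ (sInf {z | p ≤ cdf μ z}) = p := by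
  have hcont := continuous_cdf_of_nullSingletonClass μ
  have hbot := tendsto_cdf_atBot μ
  obtain ⟨z, hz⟩ : ∃ z, cdf μ z = p :=
    mem_range_of_exists_le_of_exists_ge hcont (hbot.eventually (ge_mem_nhds hp₀)).exists
      ((tendsto_cdf_atTop μ).eventually (le_mem_nhds hp₁)).exists
  have hbdd : BddBelow {z | p ≤ cdf μ z} := by
    obtain ⟨y, hy⟩ := (hbot.eventually (gt_mem_nhds hp₀)).exists
    exact ⟨y, fun w hw => le_of_not_gt fun hwy => (hy.trans_le hw).not_ge (monotone_cdf μ hwy.le)⟩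
  refine le_antisymm ?_ ?_
  · exact (monotone_cdf μ (csInf_le hbdd hz.ge)).trans_eq hz
  · exact (isClosed_le continuous_const hcont).csInf_mem ⟨z, hz.ge⟩ hbdd

theorem cdf_normalQuantile {p : ℝ} (hp₀ : 0 < p) (hp₁ : p < 1) :
    cdf (gaussianReal 0 1) (normalQuantile p) = p :=
  have := nullSingletonClass_gaussianReal (μ := 0) one_ne_zero
  cdf_sInf_setOf_le_cdf hp₀ hp₁

theorem gaussianReal_zero_Icc_normalQuantile {v p q : ℝ} (hv : 0 < v) (hp₀ : 0 < p) (hp₁ : p < 1)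
    (hq₀ : 0 < q) (hq₁ : q < 1) :
    gaussianReal 0 v.toNNReal (Set.Icc (normalQuantile p * √v) (normalQuantile q * √v)) =
      ENNReal.ofReal (q - p) := by
  have hv' : 0 < √v := Real.sqrt_pos.2 hv
  have := nullSingletonClass_gaussianReal (μ := 0) one_ne_zero
  have hmap : gaussianReal 0 v.toNNReal = (gaussianReal 0 1).map (· * √v) := by
    rw [gaussianReal_map_mul_const, mul_zero, mul_one]
    congr 1
    exact NNReal.eq ((Real.coe_toNNReal v hv.le).trans (Real.sq_sqrt hv.le).symm)
  have hpre : (· * √v) ⁻¹' Set.Icc (normalQuantile p * √v) (normalQuantile q * √v) =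
      Set.Icc (normalQuantile p) (normalQuantile q) :=
    Set.ext fun z => and_congr (mul_le_mul_iff_left₀ hv') (mul_le_mul_iff_left₀ hv')
  calc gaussianReal 0 v.toNNReal (Set.Icc (normalQuantile p * √v) (normalQuantile q * √v))
      = gaussianReal 0 1 (Set.Icc (normalQuantile p) (normalQuantile q)) := by
        rw [hmap, Measure.map_apply (by fun_prop) measurableSet_Icc, hpre]
    _ = (cdf (gaussianReal 0 1)).measure (Set.Ioc (normalQuantile p) (normalQuantile q)) := by
        rw [measure_cdf, measure_congr Ioc_ae_eq_Icc]
    _ = ENNReal.ofReal (q - p) := by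
        rw [StieltjesFunction.measure_Ioc, cdf_normalQuantile hp₀ hp₁, cdf_normalQuantile hq₀ hq₁]

end NormalQuantile

namespace BootstrapFramework

section Linearity

variable {𝒳 H : Type*} [MeasurableSpace 𝒳] (B : BootstrapFramework 𝒳 H)

instance isProbabilityMeasure_dataLaw (n : ℕ) : IsProbabilityMeasure (B.dataLaw n) := by
  unfold dataLaw
  infer_instance

instance isProbabilityMeasure_bootLaw (n : ℕ) : IsProbabilityMeasure (B.bootLaw n) := by
  unfold bootLaw
  infer_instance

theorem sqrt_mul_ψ_sub_ψ₀_sub_empProc (n : ℕ) (x : Fin n → 𝒳) :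
    √n * (B.ψ n x - B.ψ₀) - B.empProc n x B.φ₀ =
      √n * B.R n x + (B.empProc n x (B.φ n x) - B.empProc n x B.φ₀) := by
  unfold R empProc
  ring

theorem Tstar_sub_bootProc (n : ℕ) (x : Fin n → 𝒳) (w : Fin n → B.W n) :
    B.Tstar n x w - B.bootProc n x w B.φ₀ =
      √n * B.Rs n x w + (B.bootProc n x w (B.φboot n x w) - B.bootProc n x w B.φ₀) := by
  unfold Tstar Rs bootProc
  ring

theorem convOuterProb_abs_estimator_sub_empProc (hA1 : B.CondA1) (hA2 : B.CondA2)
    (hA3 : B.CondA3) :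
    ConvOuterProb B.dataLaw
      (fun n x => ENNReal.ofReal |√n * (B.ψ n x - B.ψ₀) - B.empProc n x B.φ₀|) := by
  obtain ⟨F, -, hφ₀, hφF, hG, ν, hν, hGν⟩ := hA1
  refine ((show ConvOuterProb B.dataLaw _ from hA3).add
    (hν.convOuterProb_abs_sub ⟨B.φ₀, hφ₀⟩ hG hGν hφF hA2)).mono
    (.of_forall fun n => .of_forall fun x => ?_)
  rw [sqrt_mul_ψ_sub_ψ₀_sub_empProc, ← ENNReal.ofReal_add (abs_nonneg _) (abs_nonneg _)]
  exact ENNReal.ofReal_le_ofReal (abs_add_le _ _)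

theorem condConvOuterProb_abs_Tstar_sub_bootProc (hB1 : B.CondB1) (hB2 : B.CondB2)
    (hB3 : B.CondB3) :
    CondConvOuterProb B.dataLaw B.bootLaw
      (fun n x w => ENNReal.ofReal |B.Tstar n x w - B.bootProc n x w B.φ₀|) := by
  obtain ⟨F, -, hφ₀, hφF, hG, ν, hν, hGν⟩ := hB1
  refine ((show CondConvOuterProb B.dataLaw B.bootLaw _ from hB3).add
    (hν.condConvOuterProb_abs_sub ⟨B.φ₀, hφ₀⟩ (hG.mono fun _ hn => hn.mono fun _ hx => hx.2)
      hGν hφF hB2)).mono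
    (.of_forall fun n => .of_forall fun x => .of_forall fun w => ?_)
  rw [Tstar_sub_bootProc, ← ENNReal.ofReal_add (abs_nonneg _) (abs_nonneg _)]
  exact ENNReal.ofReal_le_ofReal (abs_add_le _ _)

end Linearity

section BootstrapVariance

variable {𝒳 H : Type*} [MeasurableSpace 𝒳] (B : BootstrapFramework 𝒳 H)

theorem variance_φ₀ : Var[B.φ₀; (B.P₀ : Measure 𝒳)] = B.σ₀sq :=
  variance_of_integral_eq_zero B.φ₀_memLp.aemeasurable B.φ₀_mean

theorem integral_bridge_φ₀_sq {F : Set (𝒳 → ℝ)} {ν : Measure (EllInf F)}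
    (hν : IsBrownianBridge (B.P₀ : Measure 𝒳) F ν) (hφ₀ : B.φ₀ ∈ F) :
    ∫ z : EllInf F, z ⟨B.φ₀, hφ₀⟩ ^ 2 ∂ν = B.σ₀sq := by
  rw [← variance_φ₀, ← hν.variance_apply ⟨B.φ₀, hφ₀⟩,
    variance_of_integral_eq_zero (EllInf.measurable_apply _).aemeasurable (hν.mean _)]

theorem convOuterProb_outerLIntegral_min_bootProc_sq {F : Set (𝒳 → ℝ)} {ν : Measure (EllInf F)}
    (hG : ∀ᶠ n in atTop, ∀ᵐ x ∂(B.dataLaw n), ∀ᵐ w ∂(B.bootLaw n),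
      Memℓp (E := fun _ : F => ℝ) (fun f : F => B.bootProc n x w f) ∞)
    (hGν : CondOuterWeakConv B.dataLaw B.bootLaw
      (fun n x w => toEllInf F fun f => B.bootProc n x w f) ν) (f : F) {M : ℝ} (hM : 0 ≤ M) :
    ConvOuterProb B.dataLaw (fun n x => absDiff
      (outerLIntegral (B.bootLaw n) fun w => ENNReal.ofReal (min (B.bootProc n x w f ^ 2) M))
      (ENNReal.ofReal (∫ z, min (z f ^ 2) M ∂ν))) := by
  have hLip : LipschitzWith (2 * √M).toNNReal fun z : EllInf F => min (z f ^ 2) M := by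
    refine .of_dist_le_mul fun z z' => ?_
    rw [Real.coe_toNNReal _ (by positivity), Real.dist_eq]
    refine (abs_min_sq_sub_min_sq_le hM _ _).trans ?_
    gcongr
    exact EllInf.dist_apply_le z z' f
  refine (hGν.convOuterProb_outerLIntegral hLip (fun z => by positivity)
    fun z => min_le_right _ _).mono (hG.mono fun n hn => hn.mono fun x hx => le_of_eq ?_)
  congr 1
  exact outerLIntegral_congr_ae (hx.mono fun w hw => by simp only [toEllInf_apply hw])

theorem convOuterProb_absDiff_σbarsq (hB1 : B.CondB1) (hB2 : B.CondB2) (hB3 : B.CondB3)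
    (hT : B.AsympUnifSqIntegrable) :
    ConvOuterProb B.dataLaw
      (fun n x => absDiff (B.σbarsq n x) (ENNReal.ofReal B.σ₀sq)) := by
  have hlin := B.condConvOuterProb_abs_Tstar_sub_bootProc hB1 hB2 hB3
  obtain ⟨F, -, hφ₀, -, hG, ν, hν, hGν⟩ := hB1
  have htrunc := tendsto_integral_min_sq (hν.memLp_apply ⟨B.φ₀, hφ₀⟩)
  rw [B.integral_bridge_φ₀_sq hν hφ₀] at htrunc
  have hY (m : ℕ) := B.convOuterProb_outerLIntegral_min_bootProc_sq
    (hG.mono fun _ hn => hn.mono fun _ hx => hx.2) hGν ⟨B.φ₀, hφ₀⟩ m.cast_nonneg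
  exact convOuterProb_absDiff_outerLIntegral_sq hlin htrunc hY hT

variable {B} in
theorem convOuterProb_absDiff_σbar
    (hσ : ConvOuterProb B.dataLaw (fun n x => absDiff (B.σbarsq n x) (ENNReal.ofReal B.σ₀sq))) :
    ConvOuterProb B.dataLaw
      (fun n x => absDiff (B.σbar n x) (ENNReal.ofReal (√B.σ₀sq))) := by
  have hσ₀ : 0 ≤ B.σ₀sq := integral_nonneg fun _ => sq_nonneg _
  rw [Real.sqrt_eq_rpow, ← ENNReal.ofReal_rpow_of_nonneg hσ₀ one_half_pos.le]
  exact (hσ.rpow one_half_pos).mono (.of_forall fun n => .of_forall fun x =>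
    absDiff_rpow_le _ _ one_half_pos.le one_half_lt_one.le)

end BootstrapVariance

section Wald

variable {𝒳 H : Type*} [MeasurableSpace 𝒳] {B : BootstrapFramework 𝒳 H}

theorem measurable_empProc {f : 𝒳 → ℝ} (hf : Measurable f) (n : ℕ) :
    Measurable fun x => B.empProc n x f := by
  unfold empProc empMean
  fun_prop

theorem CondA1.measurable_φ₀ (hA1 : B.CondA1) : Measurable B.φ₀ :=
  let ⟨_, hF, hφ₀, _⟩ := hA1
  hF _ hφ₀

theorem CondA1.tendstoInDistribution_neg_empProc (hA1 : B.CondA1) :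
    TendstoInDistribution (fun n x => -B.empProc n x B.φ₀) atTop id B.dataLaw
      (gaussianReal 0 B.σ₀sq.toNNReal) := by
  have hmeas := hA1.measurable_φ₀
  obtain ⟨F, -, hφ₀, -, hG, ν, hν, hGν⟩ := hA1
  have := hν.isProbabilityMeasure
  have hcont : Continuous fun z : EllInf F => -z ⟨B.φ₀, hφ₀⟩ :=
    (EllInf.lipschitzWith_apply _).continuous.neg
  have hlim := hGν.tendstoInDistribution (A := fun n x => -B.empProc n x B.φ₀)
    (fun n => (B.measurable_empProc hmeas n).fun_neg) hcont
    (hG.mono fun n hn => hn.mono fun x hx => by rw [toEllInf_apply hx])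
  have hmap : ν.map (fun z : EllInf F => -z ⟨B.φ₀, hφ₀⟩) = gaussianReal 0 B.σ₀sq.toNNReal := by
    refine (Measure.map_map measurable_neg (EllInf.measurable_apply ⟨B.φ₀, hφ₀⟩)).symm.trans ?_
    rw [hν.map_apply, gaussianReal_map_neg, neg_zero, variance_φ₀]
  refine ⟨hlim.forall_aemeasurable, aemeasurable_id, ?_⟩
  simpa only [Measure.map_id, hmap] using hlim.tendsto

theorem mem_waldInterval_iff {α β : ℝ} {n : ℕ} (hn : 0 < n) {x : Fin n → 𝒳}
    (hσ : B.σbar n x ≠ ∞) :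
    B.ψ₀ ∈ B.waldInterval α β n x ↔ -(√n * (B.ψ n x - B.ψ₀)) ∈ Set.Icc
      (normalQuantile β * (B.σbar n x).toReal) (normalQuantile (1 - α) * (B.σbar n x).toReal) := by
  have hs : 0 < √(n : ℝ) := Real.sqrt_pos.2 (Nat.cast_pos.2 hn)
  have hcoe : ((B.σbar n x : ℝ≥0∞) : EReal) = ((B.σbar n x).toReal : EReal) := by
    rw [← EReal.toReal_coe_ennreal, EReal.coe_toReal (by simpa using hσ)
      (EReal.coe_ennreal_ne_bot _)]
  simp only [waldInterval, Set.mem_ofPred_eq, hcoe, ← EReal.coe_mul, ← EReal.coe_div,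
    ← EReal.coe_add, EReal.coe_le_coe_iff, Set.mem_Icc]
  rw [← le_sub_iff_add_le', ← sub_le_iff_le_add', div_le_iff₀ hs, le_div_iff₀ hs,
    show (B.ψ₀ - B.ψ n x) * √n = -(√n * (B.ψ n x - B.ψ₀)) by ring]

theorem tendsto_measure_symmDiff_waldInterval {α β : ℝ}
    (hσ : ConvOuterProb B.dataLaw (fun n x => absDiff (B.σbar n x) (ENNReal.ofReal √B.σ₀sq))) :
    Tendsto (fun n => B.dataLaw n (symmDiff {x | B.ψ₀ ∈ B.waldInterval α β n x}
      {x | -(√n * (B.ψ n x - B.ψ₀)) ∈ Set.Icc (normalQuantile β * (B.σbar n x).toReal)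
        (normalQuantile (1 - α) * (B.σbar n x).toReal)})) atTop (𝓝 0) := by
  refine tendsto_of_tendsto_of_tendsto_of_le_of_le' tendsto_const_nhds (hσ 1 one_pos)
    (.of_forall fun _ => zero_le) ?_
  filter_upwards [eventually_gt_atTop 0] with n hn
  refine measure_mono fun x hx => ?_
  have htop : B.σbar n x = ∞ := by
    by_contra hfin
    have hiff := mem_waldInterval_iff (α := α) (β := β) hn hfin
    exact hx.elim (fun h => h.2 (hiff.1 h.1)) fun h => h.2 (hiff.2 h.1)
  simp [htop, absDiff]

theorem convOuterProb_abs_wald_error (hlin : ConvOuterProb B.dataLaw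
      (fun n x => ENNReal.ofReal |√n * (B.ψ n x - B.ψ₀) - B.empProc n x B.φ₀|))
    (hσ : ConvOuterProb B.dataLaw (fun n x => absDiff (B.σbar n x) (ENNReal.ofReal √B.σ₀sq)))
    (u v : ℝ) :
    ConvOuterProb B.dataLaw (fun n x => ENNReal.ofReal
      (|-(√n * (B.ψ n x - B.ψ₀)) - -B.empProc n x B.φ₀| +
        |u * (B.σbar n x).toReal - u * √B.σ₀sq| + |v * (B.σbar n x).toReal - v * √B.σ₀sq|)) := by
  have hscale (c : ℝ) : ConvOuterProb B.dataLaw (fun n x => ENNReal.ofReal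
      |c * (B.σbar n x).toReal - c * √B.σ₀sq|) := by
    refine (hσ.const_mul (c := ENNReal.ofReal |c|) ENNReal.ofReal_ne_top).mono
      (.of_forall fun n => .of_forall fun x => ?_)
    rw [← mul_sub, abs_mul, ENNReal.ofReal_mul (abs_nonneg c)]
    exact mul_le_mul_right (ofReal_abs_toReal_sub_le _ (Real.sqrt_nonneg _)) _
  refine ((hlin.add (hscale u)).add (hscale v)).mono (.of_forall fun n => .of_forall fun x => ?_)
  rw [neg_sub_neg, abs_sub_comm]
  exact ENNReal.ofReal_add_le.trans (add_le_add_left ENNReal.ofReal_add_le _)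

theorem tendsto_measure_symmDiff_mem_waldInterval (hA1 : B.CondA1) (hA2 : B.CondA2)
    (hA3 : B.CondA3)
    (hσ : ConvOuterProb B.dataLaw (fun n x => absDiff (B.σbar n x) (ENNReal.ofReal √B.σ₀sq)))
    (hσ₀ : 0 < B.σ₀sq) (α β : ℝ) :
    Tendsto (fun n => B.dataLaw n (symmDiff {x | B.ψ₀ ∈ B.waldInterval α β n x}
      {x | -B.empProc n x B.φ₀ ∈
        Set.Icc (normalQuantile β * √B.σ₀sq) (normalQuantile (1 - α) * √B.σ₀sq)})) atTop (𝓝 0) := by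
  have hatoms : NullSingletonClass ((gaussianReal 0 B.σ₀sq.toNNReal).map id) := by
    simpa only [Measure.map_id] using
      nullSingletonClass_gaussianReal (Real.toNNReal_pos.2 hσ₀).ne'
  have hslutsky := tendsto_measure_symmDiff_mem_Icc hA1.tendstoInDistribution_neg_empProc
    (convOuterProb_abs_wald_error (B.convOuterProb_abs_estimator_sub_empProc hA1 hA2 hA3) hσ
      (normalQuantile β) (normalQuantile (1 - α)))
  exact tendsto_of_tendsto_of_tendsto_of_le_of_le tendsto_const_nhds
    (by simpa using (tendsto_measure_symmDiff_waldInterval hσ).add hslutsky)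
    (fun _ => zero_le) fun n => measure_symmDiff_le _ _ _

theorem CondA1.tendsto_measure_neg_empProc_mem_Icc (hA1 : B.CondA1) (hσ₀ : 0 < B.σ₀sq) {α β : ℝ}
    (hα : 0 < α) (hβ : 0 < β) (hαβ : α + β < 1) :
    Tendsto (fun n => B.dataLaw n {x | -B.empProc n x B.φ₀ ∈
      Set.Icc (normalQuantile β * √B.σ₀sq) (normalQuantile (1 - α) * √B.σ₀sq)}) atTop
      (𝓝 (ENNReal.ofReal (1 - α - β))) := by
  have hatoms : NullSingletonClass ((gaussianReal 0 B.σ₀sq.toNNReal).map id) := by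
    simpa only [Measure.map_id] using
      nullSingletonClass_gaussianReal (Real.toNNReal_pos.2 hσ₀).ne'
  have hlim := tendsto_measure_mem_Icc hA1.tendstoInDistribution_neg_empProc
    (normalQuantile β * √B.σ₀sq) (normalQuantile (1 - α) * √B.σ₀sq)
  rwa [Measure.map_id, gaussianReal_zero_Icc_normalQuantile hσ₀ hβ (by linarith) (by linarith)
    (by linarith)] at hlim

theorem tendsto_measure_mem_waldInterval (hA1 : B.CondA1) (hA2 : B.CondA2) (hA3 : B.CondA3)
    (hσ : ConvOuterProb B.dataLaw (fun n x => absDiff (B.σbar n x) (ENNReal.ofReal √B.σ₀sq)))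
    (hσ₀ : 0 < B.σ₀sq) {α β : ℝ} (hα : 0 < α) (hβ : 0 < β) (hαβ : α + β < 1) :
    Tendsto (fun n => B.dataLaw n {x | B.ψ₀ ∈ B.waldInterval α β n x}) atTop
      (𝓝 (ENNReal.ofReal (1 - α - β))) :=
  tendsto_measure_of_tendsto_measure_symmDiff
    (tendsto_measure_symmDiff_mem_waldInterval hA1 hA2 hA3 hσ hσ₀ α β)
    (hA1.tendsto_measure_neg_empProc_mem_Icc hσ₀ hα hβ hαβ)

theorem tendsto_measure_notMem_waldInterval (hA1 : B.CondA1) (hA2 : B.CondA2) (hA3 : B.CondA3)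
    (hσ : ConvOuterProb B.dataLaw (fun n x => absDiff (B.σbar n x) (ENNReal.ofReal √B.σ₀sq)))
    (hσ₀ : 0 < B.σ₀sq) {α β : ℝ} (hα : 0 < α) (hβ : 0 < β) (hαβ : α + β < 1) :
    Tendsto (fun n => B.dataLaw n {x | B.ψ₀ ∉ B.waldInterval α β n x}) atTop
      (𝓝 (ENNReal.ofReal (α + β))) := by
  have hlevel := hA1.tendsto_measure_neg_empProc_mem_Icc hσ₀ hα hβ hαβ
  have hcompl := ENNReal.Tendsto.sub (tendsto_const_nhds (x := (1 : ℝ≥0∞))) hlevel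
    (.inl ENNReal.one_ne_top)
  rw [← ENNReal.ofReal_one, ← ENNReal.ofReal_sub _ (by linarith),
    show 1 - (1 - α - β) = α + β by ring, ENNReal.ofReal_one] at hcompl
  have hsymm := tendsto_measure_symmDiff_mem_waldInterval hA1 hA2 hA3 hσ hσ₀ α β
  simp only [← compl_symmDiff_compl (a := {x | B.ψ₀ ∈ B.waldInterval α β _ x})] at hsymm
  exact tendsto_measure_of_tendsto_measure_symmDiff hsymm (hcompl.congr fun n =>
    (prob_compl_eq_one_sub ((B.measurable_empProc hA1.measurable_φ₀ n).neg measurableSet_Icc)).symm)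

end Wald

end BootstrapFramework

theorem theorem5 {𝒳 H : Type*} [MeasurableSpace 𝒳] (B : BootstrapFramework 𝒳 H)
    (hA1 : B.CondA1) (hA2 : B.CondA2) (hA3 : B.CondA3)
    (hB1 : B.CondB1) (hB2 : B.CondB2) (hB3 : B.CondB3)
    (hT : B.AsympUnifSqIntegrable) :
    -- consistency of the bootstrap variance and of the bootstrap standard deviation
    ConvOuterProb B.dataLaw (fun n x => absDiff (B.σbarsq n x) (ENNReal.ofReal B.σ₀sq)) ∧
    ConvOuterProb B.dataLaw (fun n x => absDiff (B.σbar n x) (ENNReal.ofReal (√B.σ₀sq))) ∧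
    -- asymptotic level of the bootstrap Wald interval, for outer and for inner probability
    (0 < B.σ₀sq → ∀ α β : ℝ, 0 < α → 0 < β → α + β < 1 →
      Tendsto (fun n => B.dataLaw n {x | B.ψ₀ ∈ B.waldInterval α β n x}) atTop
        (𝓝 (ENNReal.ofReal (1 - α - β))) ∧
      Tendsto (fun n => B.dataLaw n {x | B.ψ₀ ∉ B.waldInterval α β n x}) atTop
        (𝓝 (ENNReal.ofReal (α + β)))) := by
  have hvar := B.convOuterProb_absDiff_σbarsq hB1 hB2 hB3 hT
  have hsd := BootstrapFramework.convOuterProb_absDiff_σbar hvar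
  exact ⟨hvar, hsd, fun hσ₀ α β hα hβ hαβ =>
    ⟨BootstrapFramework.tendsto_measure_mem_waldInterval hA1 hA2 hA3 hsd hσ₀ hα hβ hαβ,
      BootstrapFramework.tendsto_measure_notMem_waldInterval hA1 hA2 hA3 hsd hσ₀ hα hβ hαβ⟩⟩
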